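/- Let $R$ be a commutative ring with unit. Let $\mathbb{D}$ be the small $R$-linear category with objects the triples $(r,p,n)$, $r\ge 0$, $p,n\in\mathbb{Z}$, and with morphisms generated by $\omega_{r+1}^{p,n}\colon (r,p,n)\to (r+1,p,n)$, $\delta_r^{p,n}\colon (r,p-r,n-r+1)\to (r,p,n)$ and $\sigma_r^{p,n}\colon (r+1,p+1,n+1)\to (r,p,n)$, subject to the relations $\sigma_r\omega_{r+1}=0$, $\omega_{r+1}\sigma_r=0$ and $\sigma_r\delta_{r+1}\omega_{r+1}=\delta_r$ (for all $r\ge 0$ and all bidegrees for which they make sense). These imply $\delta_r\delta_r=0$. The category $\mathsf{LWB}$ of linear witness books is the category of $R$-linear functors $\mathbb{D}^{\mathrm{op}}\to R\text{-}\mathrm{Mod}$ and natural transformations. For a linear witness book $L$, its $r$-page is the $r$-bigraded complex $(L_r,d_r)$ with $L_r^{p,n}=L(r,p,n)$ and $d_r=L(\delta_r^{p,n})\colon L_r^{p,n}\to L_r^{p-r,n+1-r}$; a morphism $f\colon K\to L$ induces morphisms of $r$-bigraded complexes $f_r\colon K_r\to L_r$. Write $\mathcal{Y}(r,p,n)$ for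 the linear witness book represented by $(r,p,n)$, and $\mathcal{Z}(r,p,n)=\mathrm{coker}\bigl(\delta_r\colon\mathcal{Y}(r,p-r,n+1-r)\to\mathcal{Y}(r,p,n)\bigr)$, which represents $L\mapsto \mathrm{Ker}(d_r\colon L_r^{p,n}\to L_r^{p-r,n+1-r})$. As $\delta_r\delta_r=0$, the map $\delta_r\colon \mathcal{Y}(r,p,n)\to\mathcal{Y}(r,p+r,n+r-1)$ induces a map $\delta_r\colon\mathcal{Z}(r,p,n)\to\mathcal{Y}(r,p+r,n+r-1)$. Put $$I_r=\{\delta_r\colon\mathcal{Z}(r,p,n)\to\mathcal{Y}(r,p+r,n+r-1)\}_{p,n\in\mathbb{Z}},\qquad J_r=\{0\to\mathcal{Y}(r,p,n)\}_{p,n\in\mathbb{Z}},$$ $$I_{\le r}=I_r\cup\bigcup_{i=0}^{r-1}J_i,\qquad J_{\le r}=\bigcup_{i=0}^{r}J_i .$$ Theorem. For each $r\ge 0$ the category $\mathsf{LWB}$, which has all small limits and colimits, carries a model category structure (with functorial factorizations) that is cofibrantly generated, with set of generating cofibrations $I_{\le r}$ and set of generating acyclic cofibrations $J_{\le r}$.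 Its fibrations are the morphisms $f$ such that $f_i$ is surjective in every bidegree for all $0\le i\le r$, and its weak equivalences are the morphisms $f$ such that $f_r$ is a quasi-isomorphism, that is, such that $H(f_r)$ is an isomorphism. -/

import Mathlib

open CategoryTheory Limits Opposite HomotopicalAlgebra

universe w v u

/-! ### The linear category of discs -/

/-- The objects of the `R`-linear category of discs: triples `(r, p, n)` with `r ≥ 0` and
`p, n` integers. -/
structure Disc (R : Type u) : Type where
  page : ℕ
  p : ℤ
  n : ℤ

namespace Disc

variable {R : Type u} [CommRing R]

/-- Formal `R`-linear combinations of formal composites of the generating morphisms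
`ω`, `δ` and `σ` (and of identities). Composites are written in diagrammatic order. -/
inductive Term (R : Type u) : Disc R → Disc R → Type u
  /-- the co-witness `ω_{r+1}^{p,n} : (r, p, n) ⟶ (r+1, p, n)` -/
  | omega (r : ℕ) (p n : ℤ) : Term R ⟨r, p, n⟩ ⟨r + 1, p, n⟩
  /-- the co-differential `δ_r^{p,n} : (r, p-r, n-r+1) ⟶ (r, p, n)` -/
  | delta (r : ℕ) {p n p' n' : ℤ} (hp : p' = p - r) (hn : n' = n - r + 1) :
      Term R ⟨r, p', n'⟩ ⟨r, p, n⟩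
  /-- the co-degeneracy `σ_r^{p,n} : (r+1, p+1, n+1) ⟶ (r, p, n)` -/
  | sigma (r : ℕ) {p n p' n' : ℤ} (hp : p' = p + 1) (hn : n' = n + 1) :
      Term R ⟨r + 1, p', n'⟩ ⟨r, p, n⟩
  | id (X : Disc R) : Term R X X
  | comp {X Y Z : Disc R} (f : Term R X Y) (g : Term R Y Z) : Term R X Z
  | zero (X Y : Disc R) : Term R X Y
  | add {X Y : Disc R} (f g : Term R X Y) : Term R X Y
  | smul {X Y : Disc R} (a : R) (f : Term R X Y) : Term R X Y

/-- The smallest congruence on formal morphisms which makes them into an `R`-linear category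
and which contains the three relations `σ_r ∘ ω_{r+1} = 0`, `ω_{r+1} ∘ σ_r = 0` and
`σ_r ∘ δ_{r+1} ∘ ω_{r+1} = δ_r`. -/
inductive Rel : {X Y : Disc R} → Term R X Y → Term R X Y → Prop
  -- the defining relations
  | sigma_omega (r : ℕ) {p n p' n' : ℤ} (hp : p = p' + 1) (hn : n = n' + 1) :
      Rel (.comp (.omega r p n) (.sigma r hp hn)) (.zero ⟨r, p, n⟩ ⟨r, p', n'⟩)
  | omega_sigma (r : ℕ) {p n p' n' : ℤ} (hp : p' = p + 1) (hn : n' = n + 1) :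
      Rel (.comp (.sigma r hp hn) (.omega r p n)) (.zero ⟨r + 1, p', n'⟩ ⟨r + 1, p, n⟩)
  | sigma_delta_omega (r : ℕ) {p n p₁ n₁ p₂ n₂ : ℤ}
      (hp : p = p₁ - (r + 1 : ℕ)) (hn : n = n₁ - (r + 1 : ℕ) + 1)
      (hp' : p₁ = p₂ + 1) (hn' : n₁ = n₂ + 1)
      (hp'' : p = p₂ - r) (hn'' : n = n₂ - r + 1) :
      Rel (.comp (.comp (.omega r p n) (.delta (r + 1) hp hn)) (.sigma r hp' hn'))
        (.delta r hp'' hn'')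
  -- equivalence relation
  | refl {X Y : Disc R} (f : Term R X Y) : Rel f f
  | symm {X Y : Disc R} {f g : Term R X Y} : Rel f g → Rel g f
  | trans {X Y : Disc R} {f g h : Term R X Y} : Rel f g → Rel g h → Rel f h
  -- compatibility with the operations
  | comp_congr {X Y Z : Disc R} {f f' : Term R X Y} {g g' : Term R Y Z} :
      Rel f f' → Rel g g' → Rel (.comp f g) (.comp f' g')
  | add_congr {X Y : Disc R} {f f' g g' : Term R X Y} :
      Rel f f' → Rel g g' → Rel (.add f g) (.add f' g')
  | smul_congr {X Y : Disc R} (a : R) {f f' : Term R X Y} :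
      Rel f f' → Rel (.smul a f) (.smul a f')
  -- axioms of a category
  | id_comp {X Y : Disc R} (f : Term R X Y) : Rel (.comp (.id X) f) f
  | comp_id {X Y : Disc R} (f : Term R X Y) : Rel (.comp f (.id Y)) f
  | assoc {X Y Z W : Disc R} (f : Term R X Y) (g : Term R Y Z) (h : Term R Z W) :
      Rel (.comp (.comp f g) h) (.comp f (.comp g h))
  -- axioms of an `R`-module
  | add_comm {X Y : Disc R} (f g : Term R X Y) : Rel (.add f g) (.add g f)
  | add_assoc {X Y : Disc R} (f g h : Term R X Y) :
      Rel (.add (.add f g) h) (.add f (.add g h))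
  | zero_add {X Y : Disc R} (f : Term R X Y) : Rel (.add (.zero X Y) f) f
  | one_smul {X Y : Disc R} (f : Term R X Y) : Rel (.smul 1 f) f
  | mul_smul {X Y : Disc R} (a b : R) (f : Term R X Y) :
      Rel (.smul (a * b) f) (.smul a (.smul b f))
  | zero_smul {X Y : Disc R} (f : Term R X Y) : Rel (.smul 0 f) (.zero X Y)
  | smul_add {X Y : Disc R} (a : R) (f g : Term R X Y) :
      Rel (.smul a (.add f g)) (.add (.smul a f) (.smul a g))
  | add_smul {X Y : Disc R} (a b : R) (f : Term R X Y) :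
      Rel (.smul (a + b) f) (.add (.smul a f) (.smul b f))
  -- composition is bilinear
  | add_comp {X Y Z : Disc R} (f g : Term R X Y) (h : Term R Y Z) :
      Rel (.comp (.add f g) h) (.add (.comp f h) (.comp g h))
  | comp_add {X Y Z : Disc R} (f : Term R X Y) (g h : Term R Y Z) :
      Rel (.comp f (.add g h)) (.add (.comp f g) (.comp f h))
  | smul_comp {X Y Z : Disc R} (a : R) (f : Term R X Y) (g : Term R Y Z) :
      Rel (.comp (.smul a f) g) (.smul a (.comp f g))
  | comp_smul {X Y Z : Disc R} (f : Term R X Y) (a : R) (g : Term R Y Z) :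
      Rel (.comp f (.smul a g)) (.smul a (.comp f g))

/-- The setoid on formal morphisms given by `Rel`. -/
def termSetoid (X Y : Disc R) : Setoid (Term R X Y) where
  r := Rel
  iseqv := ⟨Rel.refl, Rel.symm, Rel.trans⟩

/-- The linear category of discs, given by generators and relations. -/
instance category : Category.{u} (Disc R) where
  Hom X Y := Quotient (termSetoid X Y)
  id X := Quotient.mk _ (.id X)
  comp f g := Quotient.map₂ Term.comp (fun _ _ hf _ _ hg ↦ Rel.comp_congr hf hg) f g
  id_comp := by rintro X Y ⟨f⟩; exact Quotient.sound (Rel.id_comp f)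
  comp_id := by rintro X Y ⟨f⟩; exact Quotient.sound (Rel.comp_id f)
  assoc := by rintro X Y Z W ⟨f⟩ ⟨g⟩ ⟨h⟩; exact Quotient.sound (Rel.assoc f g h)

/-- The morphism represented by a formal morphism. -/
def homMk {X Y : Disc R} (f : Term R X Y) : X ⟶ Y := Quotient.mk (termSetoid X Y) f

instance homAdd (X Y : Disc R) : Add (X ⟶ Y) where
  add f g := Quotient.map₂ Term.add (fun _ _ hf _ _ hg ↦ Rel.add_congr hf hg) f g

instance homZero (X Y : Disc R) : Zero (X ⟶ Y) where
  zero := homMk (.zero X Y)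

instance homNeg (X Y : Disc R) : Neg (X ⟶ Y) where
  neg f := Quotient.map (Term.smul (-1)) (fun _ _ hf ↦ Rel.smul_congr _ hf) f

instance homAddCommGroup (X Y : Disc R) : AddCommGroup (X ⟶ Y) where
  add_assoc := by rintro ⟨f⟩ ⟨g⟩ ⟨h⟩; exact Quotient.sound (Rel.add_assoc f g h)
  zero_add := by rintro ⟨f⟩; exact Quotient.sound (Rel.zero_add f)
  add_zero := by
    rintro ⟨f⟩; exact Quotient.sound ((Rel.add_comm _ _).trans (Rel.zero_add f))
  add_comm := by rintro ⟨f⟩ ⟨g⟩; exact Quotient.sound (Rel.add_comm f g)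
  neg_add_cancel := by
    rintro ⟨f⟩
    refine Quotient.sound ((Rel.add_congr (Rel.refl _) (Rel.one_smul f).symm).trans
      ((Rel.add_smul (-1) 1 f).symm.trans ?_))
    rw [neg_add_cancel]
    exact Rel.zero_smul f
  nsmul := nsmulRec
  zsmul := zsmulRec

instance preadditive : Preadditive (Disc R) where
  add_comp := by rintro X Y Z ⟨f⟩ ⟨g⟩ ⟨h⟩; exact Quotient.sound (Rel.add_comp f g h)
  comp_add := by rintro X Y Z ⟨f⟩ ⟨g⟩ ⟨h⟩; exact Quotient.sound (Rel.comp_add f g h)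

instance homModule (X Y : Disc R) : Module R (X ⟶ Y) where
  smul a f := Quotient.map (Term.smul a) (fun _ _ hf ↦ Rel.smul_congr a hf) f
  one_smul := by rintro ⟨f⟩; exact Quotient.sound (Rel.one_smul f)
  mul_smul := by rintro a b ⟨f⟩; exact Quotient.sound (Rel.mul_smul a b f)
  smul_zero a := by
    refine Quotient.sound ((Rel.smul_congr a (Rel.zero_smul (.zero X Y)).symm).trans
      ((Rel.mul_smul a 0 _).symm.trans ?_))
    rw [mul_zero]
    exact Rel.zero_smul _
  smul_add := by rintro a ⟨f⟩ ⟨g⟩; exact Quotient.sound (Rel.smul_add a f g)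
  add_smul := by rintro a b ⟨f⟩; exact Quotient.sound (Rel.add_smul a b f)
  zero_smul := by rintro ⟨f⟩; exact Quotient.sound (Rel.zero_smul f)

instance linear : Linear R (Disc R) where
  smul_comp := by rintro X Y Z a ⟨f⟩ ⟨g⟩; exact Quotient.sound (Rel.smul_comp a f g)
  comp_smul := by rintro X Y Z ⟨f⟩ a ⟨g⟩; exact Quotient.sound (Rel.comp_smul f a g)

variable (R)

/-- The co-witness `ω_{r+1}^{p,n}`. -/
def ω (r : ℕ) (p n : ℤ) : (⟨r, p, n⟩ : Disc R) ⟶ ⟨r + 1, p, n⟩ := homMk (.omega r p n)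

/-- The co-differential `δ_r^{p,n}`, from `(r, p-r, n-r+1)` to `(r, p, n)`. -/
def δ (r : ℕ) {p n p' n' : ℤ} (hp : p' = p - r) (hn : n' = n - r + 1) :
    (⟨r, p', n'⟩ : Disc R) ⟶ ⟨r, p, n⟩ := homMk (.delta r hp hn)

/-- The co-degeneracy `σ_r^{p,n}`, from `(r+1, p+1, n+1)` to `(r, p, n)`. -/
def σ (r : ℕ) {p n p' n' : ℤ} (hp : p' = p + 1) (hn : n' = n + 1) :
    (⟨r + 1, p', n'⟩ : Disc R) ⟶ ⟨r, p, n⟩ := homMk (.sigma r hp hn)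

lemma sigma_comp_omega (r : ℕ) {p n p' n' : ℤ} (hp : p' = p + 1) (hn : n' = n + 1) :
    σ R r hp hn ≫ ω R r p n = 0 :=
  Quotient.sound (Rel.omega_sigma r hp hn)

lemma omega_delta_sigma (r : ℕ) {p n p₁ n₁ p₂ n₂ : ℤ}
    (hp : p = p₁ - (r + 1 : ℕ)) (hn : n = n₁ - (r + 1 : ℕ) + 1)
    (hp' : p₁ = p₂ + 1) (hn' : n₁ = n₂ + 1)
    (hp'' : p = p₂ - r) (hn'' : n = n₂ - r + 1) :
    (ω R r p n ≫ δ R (r + 1) hp hn) ≫ σ R r hp' hn' = δ R r hp'' hn'' :=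
  Quotient.sound (Rel.sigma_delta_omega r hp hn hp' hn' hp'' hn'')

/-- The relation `δ_r ∘ δ_r = 0` is a consequence of the defining relations. -/
lemma delta_comp_delta (r : ℕ) {p n p₁ n₁ p₂ n₂ : ℤ} (hp : p₂ = p₁ - r) (hn : n₂ = n₁ - r + 1)
    (hp' : p₁ = p - r) (hn' : n₁ = n - r + 1) :
    δ R r hp hn ≫ δ R r hp' hn' = 0 := by
  rw [← omega_delta_sigma R r (p₁ := p₁ + 1) (n₁ := n₁ + 1) (by push_cast; omega)
      (by push_cast; omega) rfl rfl hp hn,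
    ← omega_delta_sigma R r (p₁ := p + 1) (n₁ := n + 1) (by push_cast; omega)
      (by push_cast; omega) rfl rfl hp' hn']
  simp only [Category.assoc]
  rw [← Category.assoc (σ R r _ _) (ω R r _ _), sigma_comp_omega]
  simp

end Disc

/-! ### Linear witness books -/

/-- A presheaf of `R`-modules on the linear category of discs is linear if its action on
morphisms is `R`-linear. -/
def isLinearPresheaf (R : Type u) [CommRing R] :
    ObjectProperty ((Disc R)ᵒᵖ ⥤ ModuleCat.{u} R) := fun L ↦
  (∀ ⦃X Y : Disc R⦄ (f g : X ⟶ Y), L.map (f + g).op = L.map f.op + L.map g.op) ∧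
  (∀ ⦃X Y : Disc R⦄ (a : R) (f : X ⟶ Y), L.map (a • f).op = a • L.map f.op)

/-- The category of linear witness books: linear presheaves of `R`-modules on the category
of discs, with natural transformations as morphisms. -/
abbrev LWB (R : Type u) [CommRing R] := (isLinearPresheaf R).FullSubcategory

namespace LWB

variable {R : Type u} [CommRing R]

lemma map_zero (L : LWB R) (X Y : Disc R) : L.obj.map (0 : X ⟶ Y).op = 0 := by
  have h := L.property.2 (0 : R) (0 : X ⟶ Y)
  rwa [zero_smul, zero_smul] at h

lemma map_delta_comp_map_delta (L : LWB R) (r : ℕ) {p n p₁ n₁ p₂ n₂ : ℤ}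
    (hp : p₂ = p₁ - r) (hn : n₂ = n₁ - r + 1) (hp' : p₁ = p - r) (hn' : n₁ = n - r + 1) :
    L.obj.map (Disc.δ R r hp' hn').op ≫ L.obj.map (Disc.δ R r hp hn).op = 0 := by
  rw [← Functor.map_comp, ← op_comp, Disc.delta_comp_delta, map_zero]

/-- The shape of `r`-bigraded complexes: the differential has bidegree `(-r, 1-r)`. -/
abbrev pageShape (r : ℕ) : ComplexShape (ℤ × ℤ) := ComplexShape.up' (-(r : ℤ), 1 - (r : ℤ))

lemma pageShape_rel {r : ℕ} {i j : ℤ × ℤ} (h : (pageShape r).Rel i j) :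
    j.1 = i.1 - r ∧ j.2 = i.2 - r + 1 := by
  have h' : i + (-(r : ℤ), 1 - (r : ℤ)) = j := h
  subst h'
  constructor
  · simp [sub_eq_add_neg]
  · simp only [Prod.snd_add]; ring

open Classical in
/-- The `r`-page `(L_r, d_r)` of a linear witness book `L`, as an `r`-bigraded complex:
`L_r^{p,n} = L(r, p, n)` and `d_r : L_r^{p,n} ⟶ L_r^{p-r,n+1-r}` is `L(δ_r^{p,n})`. -/
@[simps]
noncomputable def pageComplex (r : ℕ) (L : LWB R) :
    HomologicalComplex (ModuleCat.{u} R) (pageShape r) where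
  X i := L.obj.obj (op ⟨r, i.1, i.2⟩)
  d i j :=
    if h : (pageShape r).Rel i j then
      L.obj.map (Disc.δ R r (pageShape_rel h).1 (pageShape_rel h).2).op
    else 0
  shape _ _ h := dif_neg h
  d_comp_d' i j k hij hjk := by
    rw [dif_pos hij, dif_pos hjk]
    exact map_delta_comp_map_delta L r _ _ _ _

/-- The functor which sends a linear witness book to its `r`-page, and a morphism `f` to `f_r`. -/
@[simps]
noncomputable def page (r : ℕ) : LWB R ⥤ HomologicalComplex (ModuleCat.{u} R) (pageShape r) where
  obj L := pageComplex r L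
  map {K L} f :=
    { f := fun i ↦ f.hom.app (op ⟨r, i.1, i.2⟩)
      comm' := fun i j hij ↦ by
        rw [pageComplex_d, pageComplex_d, dif_pos hij, dif_pos hij]
        exact (f.hom.naturality _).symm }

variable (R)

/-- The zero linear witness book. -/
def zeroBook : LWB R where
  obj := (Functor.const _).obj (ModuleCat.of R PUnit)
  property := by
    refine ⟨fun X Y f g ↦ ?_, fun X Y a f ↦ ?_⟩ <;>
    · ext x
      exact Subsingleton.elim (α := PUnit) _ _

/-- The presheaf `Hom(-, X)` represented by a disc `X`. -/
abbrev representable (X : Disc R) : (Disc R)ᵒᵖ ⥤ ModuleCat.{u} R :=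
  (linearYoneda R (Disc R)).obj X

/-- The representable linear witness book `𝒴(r, p, n) = Hom(-, (r, p, n))`. -/
@[simps]
def Y (r : ℕ) (p n : ℤ) : LWB R where
  obj := representable R ⟨r, p, n⟩
  property := by
    refine ⟨fun X Y f g ↦ ?_, fun X Y a f ↦ ?_⟩
    · ext x
      exact Preadditive.add_comp _ _ _ f g x
    · ext x
      exact Linear.smul_comp _ _ _ a f x

/-- The morphism of presheaves `Hom(-, (r, p', n')) ⟶ Hom(-, (r, p, n))` given by `δ_r^{p,n}`,
where `p' = p - r` and `n' = n - r + 1`. -/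
def deltaY (r : ℕ) {p n p' n' : ℤ} (hp : p' = p - r) (hn : n' = n - r + 1) :
    representable R ⟨r, p', n'⟩ ⟶ representable R ⟨r, p, n⟩ :=
  (linearYoneda R (Disc R)).map (Disc.δ R r hp hn)

lemma deltaY_comp_deltaY (r : ℕ) {p n p₁ n₁ p₂ n₂ : ℤ}
    (hp : p₂ = p₁ - r) (hn : n₂ = n₁ - r + 1) (hp' : p₁ = p - r) (hn' : n₁ = n - r + 1) :
    deltaY R r hp hn ≫ deltaY R r hp' hn' = 0 := by
  unfold deltaY
  rw [← Functor.map_comp, Disc.delta_comp_delta]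
  ext X x
  exact comp_zero (X := X.unop) (f := x)

lemma isLinearPresheaf_of_epi {F G : (Disc R)ᵒᵖ ⥤ ModuleCat.{u} R} (π : F ⟶ G) [Epi π]
    (hF : isLinearPresheaf R F) : isLinearPresheaf R G := by
  refine ⟨fun X Y f g ↦ ?_, fun X Y a f ↦ ?_⟩
  · rw [← cancel_epi (π.app (op Y)), ← π.naturality, hF.1, Preadditive.add_comp,
      Preadditive.comp_add, π.naturality, π.naturality]
  · rw [← cancel_epi (π.app (op Y)), ← π.naturality, hF.2, Linear.smul_comp,
      Linear.comp_smul, π.naturality]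

/-- The linear witness book `𝒵(r, p, n)` which represents `Ker d_r`: the cokernel of
`δ_r : 𝒴(r, p-r, n+1-r) ⟶ 𝒴(r, p, n)`. -/
noncomputable def Z (r : ℕ) (p n : ℤ) : LWB R where
  obj := cokernel (deltaY R r (p := p) (n := n) rfl rfl)
  property := isLinearPresheaf_of_epi R (cokernel.π _) (Y R r p n).property

/-- The morphism `δ_r : 𝒵(r, p, n) ⟶ 𝒴(r, p+r, n+r-1)` induced by
`δ_r : 𝒴(r, p, n) ⟶ 𝒴(r, p+r, n+r-1)`. -/
noncomputable def deltaZ (r : ℕ) (p n : ℤ) : Z R r p n ⟶ Y R r (p + r) (n + r - 1) :=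
  ObjectProperty.homMk
    (cokernel.desc _ (deltaY R r (by ring) (by ring)) (deltaY_comp_deltaY R r _ _ _ _))

/-- The morphism `0 ⟶ 𝒴(r, p, n)`. -/
def zeroToY (r : ℕ) (p n : ℤ) : zeroBook R ⟶ Y R r p n := ObjectProperty.homMk 0

/-- `I_r = { δ_r : 𝒵(r, p, n) ⟶ 𝒴(r, p+r, n+r-1) }`, over all integers `p, n`. -/
def I (r : ℕ) : MorphismProperty (LWB R) :=
  .ofHoms (fun i : ℤ × ℤ ↦ deltaZ R r i.1 i.2)

/-- `J_r = { 0 ⟶ 𝒴(r, p, n) }`, over all integers `p, n`. -/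
def J (r : ℕ) : MorphismProperty (LWB R) :=
  .ofHoms (fun i : ℤ × ℤ ↦ zeroToY R r i.1 i.2)

/-- `I_{≤ r}` is the union of `I_r` and of `J_i` for `0 ≤ i ≤ r - 1`. -/
def ILE (r : ℕ) : MorphismProperty (LWB R) := I R r ⊔ ⨆ i : Fin r, J R i

/-- `J_{≤ r}` is the union of `J_i` for `0 ≤ i ≤ r`. -/
def JLE (r : ℕ) : MorphismProperty (LWB R) := ⨆ i : Fin (r + 1), J R i

/-- The `r`-fibrations: morphisms `f` such that `f_i` is bidegreewise surjective
for all `0 ≤ i ≤ r`. -/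
def rFibrations (r : ℕ) : MorphismProperty (LWB R) := fun _ _ f ↦
  ∀ i : ℕ, i ≤ r → ∀ b : ℤ × ℤ, Function.Surjective (((page i).map f).f b)

/-- The `r`-weak equivalences: morphisms `f` such that `H(f_r)` is an isomorphism. -/
def rWeakEquivalences (r : ℕ) : MorphismProperty (LWB R) := fun _ _ f ↦
  QuasiIso ((page r).map f)

end LWB

/-! ### Cofibrantly generated model categories -/

section ModelCategories

variable {C : Type u} [Category.{v} C]

/-- `A` is small relative to a class of morphisms `W`: there is a regular cardinal `κ` such that
`Hom(A, -)` commutes with the colimit of every transfinite sequence of morphisms in `W` which is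
indexed by a `κ`-filtered well-ordered type. -/
def IsSmallRelativeTo (A : C) (W : MorphismProperty C) : Prop :=
  ∃ (κ : Cardinal.{w}) (_ : Fact κ.IsRegular),
    ∀ (J : Type w) [LinearOrder J] [SuccOrder J] [OrderBot J] [WellFoundedLT J]
      [IsCardinalFiltered J κ] (F : J ⥤ C) [F.IsWellOrderContinuous],
      (∀ j : J, ¬ IsMax j → W (F.map (homOfLE (Order.le_succ j)))) →
        PreservesColimit F (coyoneda.obj (op A))

/-- The relative `I`-cell complexes: transfinite compositions of pushouts of elements of `I`. -/
def relativeCells (I : MorphismProperty C) : MorphismProperty C :=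
  MorphismProperty.transfiniteCompositions.{w} I.pushouts

/-- A model category structure is cofibrantly generated, with generating cofibrations `I` and
generating trivial cofibrations `J`, if `I` and `J` are sets, the domains of `I` (resp. of `J`)
are small relative to the relative `I`-cell (resp. `J`-cell) complexes, and the fibrations
(resp. the trivial fibrations) are the morphisms with the right lifting property with respect
to `J` (resp. to `I`). -/
structure IsCofibrantlyGenerated [ModelCategory C] (I J : MorphismProperty C) : Prop where
  isSmall_I : MorphismProperty.IsSmall.{w} I
  isSmall_J : MorphismProperty.IsSmall.{w} J
  small_I : ∀ ⦃A B : C⦄ (i : A ⟶ B), I i → IsSmallRelativeTo.{w} A (relativeCells.{w} I)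
  small_J : ∀ ⦃A B : C⦄ (j : A ⟶ B), J j → IsSmallRelativeTo.{w} A (relativeCells.{w} J)
  fibrations_eq : fibrations C = J.rlp
  trivialFibrations_eq : trivialFibrations C = I.rlp

end ModelCategories

/-!
# The model structures on linear witness books

The category of discs has a very simple normal form. The relations imply `δ_r ≫ ω_{r+1} = 0` and
`σ_r ≫ δ_r = 0` (in diagrammatic order), so that every morphism is a linear combination of the
words `ω^a`, `ω^a δ`, `σ^b` and `δ σ^b` (`Disc.mem_span_words`), and a representation by
`2 × 2`-matrices shows that no multiple of `σ^b` is killed by `δ` unless it vanishes. From the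
page `r` to a disc on a page `i ≤ r` there are only the words `σ^b` and `δ σ^b`, in two
neighbouring bidegrees: the `r`-page of `𝒴(i, p, n)` is a copy of the identity of `R`, hence
exact (`Disc.exists_eq_delta_comp`).

By the Yoneda lemma, the morphisms with the right lifting property with respect to `J_{≤ r}` are
the `r`-fibrations (`LWB.rlp_JLE`), and those with the right lifting property with respect to
`I_{≤ r}` are the `r`-fibrations which are `r`-weak equivalences (`LWB.rlp_ILE`); the latter is
the usual argument for unbounded chain complexes. Limits and colimits are computed objectwise, so
that `𝒴(r, p, n)` and its quotient `𝒵(r, p, n)` are finitely presentable, and the small object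
argument provides both functorial factorizations.

It remains to see that the morphisms with the left lifting property with respect to the
`r`-fibrations are `r`-weak equivalences (`LWB.llp_rFibrations_le`). No transfinite composition is
needed: `K ⟶ L` is the composition of the inclusion of `K` into its direct sum with a sum of
representables `𝒴(i, p, n)`, `i ≤ r`, and of an `r`-fibration. The inclusion is an `r`-weak
equivalence by the exactness above, and the retract argument applies. Another retract
argument shows that acyclic cofibrations lift against fibrations.
-/

/-! ### Normal forms in the category of discs -/

namespace Disc

variable {R : Type u} [CommRing R]

lemma omega_comp_sigma (r : ℕ) {p n p' n' : ℤ} (hp : p = p' + 1) (hn : n = n' + 1) :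
    ω R r p n ≫ σ R r hp hn = 0 :=
  Quotient.sound (Rel.sigma_omega r hp hn)

lemma omega_comp_delta_comp_sigma (r : ℕ) {p n p₁ n₁ p₂ n₂ : ℤ}
    (hp : p = p₁ - (r + 1 : ℕ)) (hn : n = n₁ - (r + 1 : ℕ) + 1)
    (hp' : p₁ = p₂ + 1) (hn' : n₁ = n₂ + 1) :
    ω R r p n ≫ δ R (r + 1) hp hn ≫ σ R r hp' hn' =
      δ R r (p := p₂) (n := n₂) (by push_cast at hp; omega) (by push_cast at hn; omega) := by
  rw [← omega_delta_sigma R r hp hn hp' hn', Category.assoc]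

/-- Writing `δ_r` as `σ_r δ_{r+1} ω_{r+1}`, this follows from `ω_{r+1} σ_r = 0`. -/
lemma delta_comp_omega (r : ℕ) {p n p' n' : ℤ} (hp : p' = p - r) (hn : n' = n - r + 1) :
    δ R r hp hn ≫ ω R r p n = 0 := by
  rw [← omega_delta_sigma R r (p₁ := p + 1) (n₁ := n + 1) (by push_cast; omega)
    (by push_cast; omega) rfl rfl hp hn, Category.assoc, sigma_comp_omega, comp_zero]

/-- Writing `δ_r` as `σ_r δ_{r+1} ω_{r+1}`, this follows from `ω_{r+1} σ_r = 0`. -/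
lemma sigma_comp_delta (r : ℕ) {p n p' n' p₁ n₁ : ℤ} (hp : p' = p - r) (hn : n' = n - r + 1)
    (hp' : p₁ = p' + 1) (hn' : n₁ = n' + 1) :
    σ R r hp' hn' ≫ δ R r hp hn = 0 := by
  rw [← omega_delta_sigma R r (p₁ := p + 1) (n₁ := n + 1) (by push_cast; omega)
    (by push_cast; omega) rfl rfl hp hn, ← Category.assoc, ← Category.assoc, sigma_comp_omega,
    zero_comp, zero_comp]

/-- Iterated co-degeneracies `σ ≫ σ ≫ ⋯ ≫ σ`. -/
inductive SigmaPow : ∀ {X Y : Disc R}, (X ⟶ Y) → Prop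
  | id (X : Disc R) : SigmaPow (𝟙 X)
  | comp (r : ℕ) {p n p' n' : ℤ} (hp : p' = p + 1) (hn : n' = n + 1) {Y : Disc R}
      {f : ⟨r, p, n⟩ ⟶ Y} (hf : SigmaPow f) : SigmaPow (σ R r hp hn ≫ f)

/-- Iterated co-witnesses `ω ≫ ω ≫ ⋯ ≫ ω`. -/
inductive OmegaPow : ∀ {X Y : Disc R}, (X ⟶ Y) → Prop
  | id (X : Disc R) : OmegaPow (𝟙 X)
  | comp (r : ℕ) (p n : ℤ) {Y : Disc R}
      {f : ⟨r + 1, p, n⟩ ⟶ Y} (hf : OmegaPow f) : OmegaPow (ω R r p n ≫ f)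

/-- The morphisms in normal form: a power of `σ`, possibly preceded by a `δ`, or a power of `ω`,
possibly followed by a `δ`. -/
inductive IsWord : ∀ {X Y : Disc R}, (X ⟶ Y) → Prop
  | sigma {X Y : Disc R} {f : X ⟶ Y} (hf : SigmaPow f) : IsWord f
  | deltaSigma (r : ℕ) {p n p' n' : ℤ} (hp : p' = p - r) (hn : n' = n - r + 1) {Y : Disc R}
      {f : ⟨r, p, n⟩ ⟶ Y} (hf : SigmaPow f) : IsWord (δ R r hp hn ≫ f)
  | omega {X Y : Disc R} {f : X ⟶ Y} (hf : OmegaPow f) : IsWord f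
  | omegaDelta (r : ℕ) {p n p' n' : ℤ} (hp : p' = p - r) (hn : n' = n - r + 1) {X : Disc R}
      {f : X ⟶ ⟨r, p', n'⟩} (hf : OmegaPow f) : IsWord (f ≫ δ R r hp hn)

lemma IsWord.omega_comp (r : ℕ) (p n : ℤ) {Y : Disc R} {f : ⟨r + 1, p, n⟩ ⟶ Y} (hf : IsWord f) :
    ω R r p n ≫ f = 0 ∨ IsWord (ω R r p n ≫ f) := by
  cases hf with
  | sigma hf =>
    cases hf with
    | id => exact .inr (.omega (.comp _ _ _ (.id _)))
    | comp _ hp hn hf =>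
      left
      rw [← Category.assoc, omega_comp_sigma, zero_comp]
  | deltaSigma _ hp hn hf =>
    cases hf with
    | id =>
      right
      have := IsWord.omegaDelta (R := R) (r + 1) hp hn (.comp r p n (.id _))
      simpa using this
    | comp _ hp' hn' hf =>
      right
      have := omega_comp_delta_comp_sigma (R := R) r hp hn hp' hn'
      rw [← Category.assoc, ← Category.assoc, Category.assoc (ω R r p n), this]
      exact .deltaSigma _ _ _ hf
  | omega hf => exact .inr (.omega (.comp _ _ _ hf))
  | omegaDelta _ hp hn hf =>
    right
    rw [← Category.assoc]
    exact .omegaDelta _ hp hn (.comp _ _ _ hf)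

lemma IsWord.delta_comp (r : ℕ) {p n p' n' : ℤ} (hp : p' = p - r) (hn : n' = n - r + 1)
    {Y : Disc R} {f : ⟨r, p, n⟩ ⟶ Y} (hf : IsWord f) :
    δ R r hp hn ≫ f = 0 ∨ IsWord (δ R r hp hn ≫ f) := by
  cases hf with
  | sigma hf => exact .inr (.deltaSigma _ hp hn hf)
  | deltaSigma _ hp' hn' hf =>
    left
    rw [← Category.assoc, delta_comp_delta, zero_comp]
  | omega hf =>
    cases hf with
    | id => exact .inr (.deltaSigma _ hp hn (.id _))
    | comp _ _ _ hf =>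
      left
      rw [← Category.assoc, delta_comp_omega, zero_comp]
  | omegaDelta _ hp' hn' hf =>
    left
    cases hf with
    | id => rw [Category.id_comp, delta_comp_delta]
    | comp _ _ _ hf =>
      rw [← Category.assoc, ← Category.assoc, delta_comp_omega, zero_comp, zero_comp]

lemma IsWord.sigma_comp (r : ℕ) {p n p' n' : ℤ} (hp : p' = p + 1) (hn : n' = n + 1)
    {Y : Disc R} {f : ⟨r, p, n⟩ ⟶ Y} (hf : IsWord f) :
    σ R r hp hn ≫ f = 0 ∨ IsWord (σ R r hp hn ≫ f) := by
  cases hf with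
  | sigma hf => exact .inr (.sigma (.comp _ hp hn hf))
  | deltaSigma _ hp' hn' hf =>
    left
    rw [← Category.assoc, sigma_comp_delta, zero_comp]
  | omega hf =>
    cases hf with
    | id => exact .inr (.sigma (.comp _ hp hn (.id _)))
    | comp _ _ _ hf =>
      left
      rw [← Category.assoc, sigma_comp_omega, zero_comp]
  | omegaDelta _ hp' hn' hf =>
    left
    cases hf with
    | id => rw [Category.id_comp, sigma_comp_delta]
    | comp _ _ _ hf =>
      rw [← Category.assoc, ← Category.assoc, sigma_comp_omega, zero_comp, zero_comp]

/-- Submodules spanned by words are stable under precomposition with `g` as soon as the product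
of `g` with a word is zero or a word. -/
lemma comp_mem_span_words {X Y Z : Disc R} (g : X ⟶ Y)
    (hg : ∀ f : Y ⟶ Z, IsWord f → g ≫ f = 0 ∨ IsWord (g ≫ f)) {f : Y ⟶ Z}
    (hf : f ∈ Submodule.span R {f : Y ⟶ Z | IsWord f}) :
    g ≫ f ∈ Submodule.span R {f : X ⟶ Z | IsWord f} := by
  induction hf using Submodule.span_induction with
  | mem f hf =>
    obtain h | h := hg f hf
    · rw [h]; exact Submodule.zero_mem _
    · exact Submodule.subset_span h
  | zero => rw [comp_zero]; exact Submodule.zero_mem _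
  | add f f' _ _ hf hf' => rw [Preadditive.comp_add]; exact Submodule.add_mem _ hf hf'
  | smul a f _ hf => rw [Linear.comp_smul]; exact Submodule.smul_mem _ _ hf

lemma homMk_comp_mem_span_words {X Y : Disc R} (t : Term R X Y) {Z : Disc R} {f : Y ⟶ Z}
    (hf : f ∈ Submodule.span R {f : Y ⟶ Z | IsWord f}) :
    homMk t ≫ f ∈ Submodule.span R {f : X ⟶ Z | IsWord f} := by
  induction t generalizing Z with
  | omega r p n => exact comp_mem_span_words (ω R r p n) (fun _ h ↦ h.omega_comp _ _ _) hf
  | delta r hp hn => exact comp_mem_span_words (δ R r hp hn) (fun _ h ↦ h.delta_comp _ _ _) hf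
  | sigma r hp hn => exact comp_mem_span_words (σ R r hp hn) (fun _ h ↦ h.sigma_comp _ _ _) hf
  | id X => exact (Category.id_comp f).symm ▸ hf
  | comp s t hs ht =>
    have : homMk (s.comp t) ≫ f = homMk s ≫ homMk t ≫ f := Category.assoc (homMk s) (homMk t) f
    rw [this]
    exact hs (ht hf)
  | zero X Y =>
    have : homMk (.zero X Y) ≫ f = 0 := zero_comp (X := X) (f := f)
    rw [this]
    exact Submodule.zero_mem _
  | add s t hs ht =>
    have : homMk (s.add t) ≫ f = homMk s ≫ f + homMk t ≫ f :=
      Preadditive.add_comp _ _ _ (homMk s) (homMk t) f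
    rw [this]
    exact Submodule.add_mem _ (hs hf) (ht hf)
  | smul a t ht =>
    have : homMk (t.smul a) ≫ f = a • (homMk t ≫ f) := Linear.smul_comp _ _ _ a (homMk t) f
    rw [this]
    exact Submodule.smul_mem _ _ (ht hf)

/-- Every morphism is a linear combination of words. -/
lemma mem_span_words {X Y : Disc R} (f : X ⟶ Y) :
    f ∈ Submodule.span R {f : X ⟶ Y | IsWord f} := by
  obtain ⟨t, rfl⟩ := Quotient.exists_rep f
  have := homMk_comp_mem_span_words t (f := 𝟙 Y) (Submodule.subset_span (.sigma (.id Y)))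
  rwa [Category.comp_id] at this

lemma SigmaPow.degree {X Y : Disc R} {f : X ⟶ Y} (hf : SigmaPow f) :
    Y.page ≤ X.page ∧ X.p - Y.p = X.page - Y.page ∧ X.n - Y.n = X.page - Y.page := by
  induction hf with
  | id => simp
  | comp r hp hn hf ih =>
    dsimp only at ih ⊢
    push_cast
    omega

lemma SigmaPow.unique {X Y : Disc R} {f g : X ⟶ Y} (hf : SigmaPow f) (hg : SigmaPow g) :
    f = g := by
  induction hf with
  | id X =>
    cases hg with
    | id => rfl
    | comp r hp hn hg => have := hg.degree; dsimp only at this; omega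
  | comp r hp hn hf ih =>
    cases hg with
    | id => have := hf.degree; dsimp only at this; omega
    | comp _ hp' hn' hg =>
      obtain rfl := add_right_cancel (hp.symm.trans hp')
      obtain rfl := add_right_cancel (hn.symm.trans hn')
      rw [ih hg]

lemma OmegaPow.page_le {X Y : Disc R} {f : X ⟶ Y} (hf : OmegaPow f) : X.page ≤ Y.page := by
  induction hf with
  | id => exact le_rfl
  | comp r p n hf ih => exact (Nat.le_succ r).trans ih

/-- A word which does not raise the page is a power of `σ`, or is such a power preceded by
a `δ`. -/
lemma IsWord.of_page_le {r : ℕ} {p n p₁ n₁ : ℤ} (hp : p = p₁ - r) (hn : n = n₁ - r + 1)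
    {Y : Disc R} (hY : Y.page ≤ r) {f : ⟨r, p, n⟩ ⟶ Y} (hf : IsWord f) :
    SigmaPow f ∨ ∃ g : ⟨r, p₁, n₁⟩ ⟶ Y, SigmaPow g ∧ f = δ R r hp hn ≫ g := by
  cases hf with
  | sigma hf => exact .inl hf
  | @deltaSigma _ p' n' _ _ hp' hn' _ g hg =>
    obtain rfl : p' = p₁ := by omega
    obtain rfl : n' = n₁ := by omega
    exact .inr ⟨g, hg, rfl⟩
  | omega hf =>
    cases hf with
    | id => exact .inl (.id _)
    | comp _ _ _ hf => have := hf.page_le; dsimp only at this; omega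
  | @omegaDelta _ p' n' _ _ hp' hn' _ g hg =>
    cases hg with
    | id =>
      obtain rfl : p' = p₁ := by omega
      obtain rfl : n' = n₁ := by omega
      exact .inr ⟨𝟙 _, .id _, by simp⟩
    | comp _ _ _ hg => have := hg.page_le; dsimp only at this hY; omega

/-- The representation of the category of discs by `2 × 2`-matrices in which `σ`, `ω` and `δ` act
by the elementary matrices `E₁₁`, `E₂₂` and `E₂₁` (with composition in diagrammatic order). -/
def Term.toMatrix {X Y : Disc R} : Term R X Y → Matrix (Fin 2) (Fin 2) R
  | .omega _ _ _ => !![0, 0; 0, 1]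
  | .delta _ _ _ => !![0, 0; 1, 0]
  | .sigma _ _ _ => !![1, 0; 0, 0]
  | .id _ => 1
  | .comp f g => f.toMatrix * g.toMatrix
  | .zero _ _ => 0
  | .add f g => f.toMatrix + g.toMatrix
  | .smul a f => a • f.toMatrix

lemma Rel.toMatrix_eq {X Y : Disc R} {s t : Term R X Y} (h : Rel s t) :
    s.toMatrix = t.toMatrix := by
  induction h with
  | sigma_omega => ext i j; fin_cases i <;> fin_cases j <;> simp [Term.toMatrix]
  | omega_sigma => ext i j; fin_cases i <;> fin_cases j <;> simp [Term.toMatrix]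
  | sigma_delta_omega => ext i j; fin_cases i <;> fin_cases j <;> simp [Term.toMatrix]
  | refl => rfl
  | symm _ h => exact h.symm
  | trans _ _ h h' => exact h.trans h'
  | comp_congr _ _ h h' => simp only [Term.toMatrix, h, h']
  | add_congr _ _ h h' => simp only [Term.toMatrix, h, h']
  | smul_congr a _ h => simp only [Term.toMatrix, h]
  | id_comp => simp [Term.toMatrix]
  | comp_id => simp [Term.toMatrix]
  | assoc => simp [Term.toMatrix, Matrix.mul_assoc]
  | add_comm => exact _root_.add_comm _ _
  | add_assoc => exact _root_.add_assoc _ _ _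
  | zero_add => exact _root_.zero_add _
  | one_smul => exact _root_.one_smul _ _
  | mul_smul => exact SemigroupAction.mul_smul _ _ _
  | zero_smul => exact _root_.zero_smul _ _
  | smul_add => exact _root_.smul_add _ _ _
  | add_smul => exact _root_.add_smul _ _ _
  | add_comp => simp [Term.toMatrix, Matrix.add_mul]
  | comp_add => simp [Term.toMatrix, Matrix.mul_add]
  | smul_comp => simp [Term.toMatrix]
  | comp_smul => simp [Term.toMatrix]

/-- The matrix of a morphism in the category of discs, see `Disc.Term.toMatrix`. -/
def toMatrix {X Y : Disc R} (f : X ⟶ Y) : Matrix (Fin 2) (Fin 2) R :=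
  Quotient.lift Term.toMatrix (fun _ _ h ↦ Rel.toMatrix_eq h) f

lemma toMatrix_comp {X Y Z : Disc R} (f : X ⟶ Y) (g : Y ⟶ Z) :
    toMatrix (f ≫ g) = toMatrix f * toMatrix g := by
  obtain ⟨f, rfl⟩ := Quotient.exists_rep f
  obtain ⟨g, rfl⟩ := Quotient.exists_rep g
  rfl

lemma toMatrix_smul {X Y : Disc R} (a : R) (f : X ⟶ Y) : toMatrix (a • f) = a • toMatrix f := by
  obtain ⟨f, rfl⟩ := Quotient.exists_rep f
  rfl

lemma toMatrix_zero (X Y : Disc R) : toMatrix (0 : X ⟶ Y) = 0 := rfl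

lemma toMatrix_delta (r : ℕ) {p n p' n' : ℤ} (hp : p' = p - r) (hn : n' = n - r + 1) :
    toMatrix (δ R r hp hn) = !![0, 0; 1, 0] := rfl

lemma SigmaPow.toMatrix_apply {X Y : Disc R} {f : X ⟶ Y} (hf : SigmaPow f) :
    toMatrix f 0 0 = 1 := by
  induction hf with
  | id => rfl
  | comp r hp hn hf ih =>
    have : toMatrix (σ R r hp hn) = !![1, 0; 0, 0] := rfl
    simp [toMatrix_comp, this, Matrix.mul_apply, ih]

lemma SigmaPow.eq_zero_of_smul {r : ℕ} {p n p' n' : ℤ} (hp : p' = p - r) (hn : n' = n - r + 1)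
    {Y : Disc R} {f : ⟨r, p, n⟩ ⟶ Y} (hf : SigmaPow f) (a : R)
    (h : δ R r hp hn ≫ (a • f) = 0) : a = 0 := by
  have := congrArg (fun f ↦ toMatrix f 1 0) h
  simpa [toMatrix_comp, toMatrix_smul, toMatrix_zero, toMatrix_delta, Matrix.mul_apply,
    Fin.sum_univ_two, -Matrix.cons_mul, hf.toMatrix_apply] using this

/-- The complexes formed by the morphisms from the discs on page `r` to a fixed disc which does
not lie on a higher page are exact: they are sums of copies of the identity of `R`, spanned by
`σ^b` and `δσ^b`. -/
theorem exists_eq_delta_comp {r : ℕ} {p n p₁ n₁ p₂ n₂ : ℤ} (hp : p = p₁ - r)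
    (hn : n = n₁ - r + 1) (hp' : p₂ = p - r) (hn' : n₂ = n - r + 1) {Y : Disc R}
    (hY : Y.page ≤ r) (f : ⟨r, p, n⟩ ⟶ Y) (hf : δ R r hp' hn' ≫ f = 0) :
    ∃ g : ⟨r, p₁, n₁⟩ ⟶ Y, f = δ R r hp hn ≫ g := by
  have hf' := mem_span_words f
  -- The difference of the two degrees tells powers of `σ` from those preceded by a `δ`.
  by_cases hdeg : n - p = Y.n - Y.p
  · suffices ∃ a : R, ∃ g : ⟨r, p, n⟩ ⟶ Y, f = a • g ∧ (a ≠ 0 → SigmaPow g) by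
      obtain ⟨a, g, rfl, hg⟩ := this
      have ha : a = 0 := by
        by_contra ha
        exact ha ((hg ha).eq_zero_of_smul hp' hn' a hf)
      exact ⟨0, by rw [ha, zero_smul, comp_zero]⟩
    clear hf
    induction hf' using Submodule.span_induction with
    | mem f hf =>
      obtain hf | ⟨g, hg, rfl⟩ := IsWord.of_page_le hp hn hY hf
      · exact ⟨1, f, (one_smul _ _).symm, fun _ ↦ hf⟩
      · have := hg.degree
        dsimp only at this
        omega
    | zero => exact ⟨0, 0, (zero_smul _ _).symm, fun h ↦ (h rfl).elim⟩
    | add f f' _ _ hf hf' =>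
      obtain ⟨a, g, rfl, hg⟩ := hf
      obtain ⟨a', g', rfl, hg'⟩ := hf'
      by_cases ha : a = 0
      · exact ⟨a', g', by rw [ha, zero_smul, zero_add], hg'⟩
      by_cases ha' : a' = 0
      · exact ⟨a, g, by rw [ha', zero_smul, add_zero], hg⟩
      exact ⟨a + a', g, by rw [(hg ha).unique (hg' ha'), add_smul], fun _ ↦ hg ha⟩
    | smul b f _ hf =>
      obtain ⟨a, g, rfl, hg⟩ := hf
      exact ⟨b * a, g, (mul_smul _ _ _).symm, fun h ↦ hg (right_ne_zero_of_mul h)⟩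
  · clear hf
    induction hf' using Submodule.span_induction with
    | mem f hf =>
      obtain hf | ⟨g, hg, rfl⟩ := IsWord.of_page_le hp hn hY hf
      · have := hf.degree
        dsimp only at this
        omega
      · exact ⟨g, rfl⟩
    | zero => exact ⟨0, comp_zero.symm⟩
    | add f f' _ _ hf hf' =>
      obtain ⟨g, rfl⟩ := hf
      obtain ⟨g', rfl⟩ := hf'
      exact ⟨g + g', (Preadditive.comp_add _ _ _ _ _ _).symm⟩
    | smul b f _ hf =>
      obtain ⟨g, rfl⟩ := hf
      exact ⟨b • g, (Linear.comp_smul _ _ _ _ _ _).symm⟩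

end Disc

namespace LWB

/-! ### Limits and colimits of linear witness books -/

section Limits

variable (R : Type u) [CommRing R]

instance isLinearPresheaf_isClosedUnderLimitsOfShape (J : Type u) [Category.{u} J] :
    (isLinearPresheaf R).IsClosedUnderLimitsOfShape J where
  limitsOfShape_le := by
    rintro L ⟨h⟩
    have hL (X : (Disc R)ᵒᵖ) := isLimitOfPreserves ((evaluation _ _).obj X) h.isLimit
    have hπ {X Y : (Disc R)ᵒᵖ} (f : X ⟶ Y) (j : J) :
        L.map f ≫ (h.π.app j).app Y = (h.π.app j).app X ≫ (h.diag.obj j).map f :=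
      (h.π.app j).naturality f
    refine ⟨fun X Y f g ↦ (hL (op X)).hom_ext fun j ↦ ?_,
      fun X Y a f ↦ (hL (op X)).hom_ext fun j ↦ ?_⟩
    · change _ ≫ (h.π.app j).app (op X) = _ ≫ (h.π.app j).app (op X)
      rw [Preadditive.add_comp, hπ, hπ, hπ, (h.prop_diag_obj j).1, Preadditive.comp_add]
    · change _ ≫ (h.π.app j).app (op X) = _ ≫ (h.π.app j).app (op X)
      rw [Linear.smul_comp, hπ, hπ, (h.prop_diag_obj j).2, Linear.comp_smul]

instance isLinearPresheaf_isClosedUnderColimitsOfShape (J : Type u) [Category.{u} J] :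
    (isLinearPresheaf R).IsClosedUnderColimitsOfShape J where
  colimitsOfShape_le := by
    rintro L ⟨h⟩
    have hL (X : (Disc R)ᵒᵖ) := isColimitOfPreserves ((evaluation _ _).obj X) h.isColimit
    have hι {X Y : (Disc R)ᵒᵖ} (f : X ⟶ Y) (j : J) :
        (h.ι.app j).app X ≫ L.map f = (h.diag.obj j).map f ≫ (h.ι.app j).app Y :=
      ((h.ι.app j).naturality f).symm
    refine ⟨fun X Y f g ↦ (hL (op Y)).hom_ext fun j ↦ ?_,
      fun X Y a f ↦ (hL (op Y)).hom_ext fun j ↦ ?_⟩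
    · change (h.ι.app j).app (op Y) ≫ _ = (h.ι.app j).app (op Y) ≫ _
      rw [Preadditive.comp_add, hι, hι, hι, (h.prop_diag_obj j).1, Preadditive.add_comp]
    · change (h.ι.app j).app (op Y) ≫ _ = (h.ι.app j).app (op Y) ≫ _
      rw [Linear.comp_smul, hι, hι, (h.prop_diag_obj j).2, Linear.smul_comp]

instance hasLimitsOfSize : HasLimitsOfSize.{u, u} (LWB R) where
  has_limits_of_shape _ _ := inferInstance

instance hasColimitsOfSize : HasColimitsOfSize.{u, u} (LWB R) where
  has_colimits_of_shape _ _ := inferInstance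

instance preservesColimits_ι : PreservesColimitsOfSize.{u, u} (isLinearPresheaf R).ι where
  preservesColimitsOfShape := inferInstance

end Limits

/-! ### Elements of linear witness books -/

variable {R : Type u} [CommRing R]

lemma hom_ext_apply {K L : LWB R} {f g : K ⟶ L}
    (h : ∀ (X : Disc R) (x : K.obj.obj (op X)), f.hom.app (op X) x = g.hom.app (op X) x) :
    f = g := by
  ext X x
  exact h X.unop x

lemma naturality_apply {K L : LWB R} (f : K ⟶ L) {X Y : Disc R} (g : X ⟶ Y)
    (x : K.obj.obj (op Y)) :
    f.hom.app (op X) (K.obj.map g.op x) = L.obj.map g.op (f.hom.app (op Y) x) :=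
  congr($(f.hom.naturality g.op) x)

lemma comp_app_apply {K L M : LWB R} (f : K ⟶ L) (g : L ⟶ M) {X : Disc R}
    (x : K.obj.obj (op X)) :
    (f ≫ g).hom.app (op X) x = g.hom.app (op X) (f.hom.app (op X) x) := rfl

lemma map_comp_apply (L : LWB R) {X Y Z : Disc R} (f : X ⟶ Y) (g : Y ⟶ Z)
    (x : L.obj.obj (op Z)) :
    L.obj.map (f ≫ g).op x = L.obj.map f.op (L.obj.map g.op x) := by
  rw [op_comp, Functor.map_comp]
  rfl

lemma map_id_apply (L : LWB R) {X : Disc R} (x : L.obj.obj (op X)) :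
    L.obj.map (𝟙 X).op x = x :=
  congr($(L.obj.map_id (op X)) x)

lemma map_delta_map_delta (L : LWB R) (r : ℕ) {p n p₁ n₁ p₂ n₂ : ℤ}
    (hp : p₂ = p₁ - r) (hn : n₂ = n₁ - r + 1) (hp' : p₁ = p - r) (hn' : n₁ = n - r + 1)
    (x : L.obj.obj (op ⟨r, p, n⟩)) :
    L.obj.map (Disc.δ R r hp hn).op (L.obj.map (Disc.δ R r hp' hn').op x) = 0 :=
  congr($(map_delta_comp_map_delta L r hp hn hp' hn') x)

/-- The morphism from a representable presheaf to a linear witness book given by an element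
(the Yoneda lemma). -/
def representableDesc {L : LWB R} {X : Disc R} (x : L.obj.obj (op X)) :
    representable R X ⟶ L.obj where
  app Z := ModuleCat.ofHom
    { toFun h := L.obj.map (Quiver.Hom.op (h : Z.unop ⟶ X)) x
      map_add' f g := congr($(L.property.1 (X := Z.unop) f g) x)
      map_smul' a f := congr($(L.property.2 (X := Z.unop) a f) x) }
  naturality Z W g := by
    ext h
    exact L.map_comp_apply g.unop (h : Z.unop ⟶ X) x

/-- The morphism `𝒴(r, p, n) ⟶ L` corresponding to an element of `L(r, p, n)`. -/
def ofElement {L : LWB R} {r : ℕ} {p n : ℤ} (x : L.obj.obj (op ⟨r, p, n⟩)) : Y R r p n ⟶ L :=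
  ObjectProperty.homMk (representableDesc x)

/-- The universal element of `𝒴(r, p, n)`. -/
def universalElement (R : Type u) [CommRing R] (r : ℕ) (p n : ℤ) :
    (Y R r p n).obj.obj (op ⟨r, p, n⟩) :=
  (𝟙 _ : (⟨r, p, n⟩ : Disc R) ⟶ _)

lemma map_universalElement {r : ℕ} {p n : ℤ} {X : Disc R} (g : X ⟶ ⟨r, p, n⟩) :
    (Y R r p n).obj.map g.op (universalElement R r p n) = g :=
  Category.comp_id g

lemma ofElement_universalElement {L : LWB R} {r : ℕ} {p n : ℤ} (x : L.obj.obj (op ⟨r, p, n⟩)) :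
    (ofElement x).hom.app _ (universalElement R r p n) = x :=
  map_id_apply L x

lemma Y_hom_ext {L : LWB R} {r : ℕ} {p n : ℤ} {f g : Y R r p n ⟶ L}
    (h : f.hom.app _ (universalElement R r p n) = g.hom.app _ (universalElement R r p n)) :
    f = g := by
  refine hom_ext_apply fun X (x : X ⟶ ⟨r, p, n⟩) ↦ ?_
  have := congr(L.obj.map x.op $h)
  rwa [← naturality_apply, ← naturality_apply, map_universalElement] at this

/-- The projection `𝒴(r, p, n) ⟶ 𝒵(r, p, n)`. -/
noncomputable def πZ (R : Type u) [CommRing R] (r : ℕ) (p n : ℤ) : Y R r p n ⟶ Z R r p n :=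
  ObjectProperty.homMk (cokernel.π (deltaY R r rfl rfl))

/-- The morphism `𝒴(r, p', n') ⟶ 𝒴(r, p, n)` given by `δ_r`. -/
def deltaYHom (R : Type u) [CommRing R] (r : ℕ) {p n p' n' : ℤ} (hp : p' = p - r)
    (hn : n' = n - r + 1) : Y R r p' n' ⟶ Y R r p n :=
  ObjectProperty.homMk (deltaY R r hp hn)

lemma deltaYHom_universalElement (r : ℕ) {p n p' n' : ℤ} (hp : p' = p - r)
    (hn : n' = n - r + 1) :
    (deltaYHom R r hp hn).hom.app _ (universalElement R r p' n') =
      (Y R r p n).obj.map (Disc.δ R r hp hn).op (universalElement R r p n) := by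
  rw [map_universalElement]
  exact Category.id_comp (Disc.δ R r hp hn)

lemma deltaYHom_comp_πZ (r : ℕ) (p n : ℤ) :
    deltaYHom R r rfl rfl ≫ πZ R r p n = 0 := by
  ext : 1
  exact cokernel.condition (deltaY R r (p := p) (n := n) rfl rfl)

lemma πZ_comp_deltaZ (r : ℕ) (p n : ℤ) :
    πZ R r p n ≫ deltaZ R r p n = deltaYHom R r (by ring) (by ring) := by
  ext : 1
  exact cokernel.π_desc _ _ _

lemma deltaYHom_comp_eq_zero_iff {L : LWB R} {r : ℕ} {p n p' n' : ℤ} (hp : p' = p - r)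
    (hn : n' = n - r + 1) (f : Y R r p n ⟶ L) :
    deltaYHom R r hp hn ≫ f = 0 ↔
      L.obj.map (Disc.δ R r hp hn).op (f.hom.app _ (universalElement R r p n)) = 0 := by
  rw [← naturality_apply, ← deltaYHom_universalElement]
  exact ⟨fun h ↦ congr(($h).hom.app _ (universalElement R r p' n')), fun h ↦ Y_hom_ext h⟩

/-- `𝒵(r, p, n)` is the cokernel of `δ_r` in the category of linear witness books. -/
noncomputable def isColimitZ (R : Type u) [CommRing R] (r : ℕ) (p n : ℤ) :
    IsColimit (CokernelCofork.ofπ (πZ R r p n) (deltaYHom_comp_πZ r p n)) :=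
  CokernelCofork.IsColimit.ofπ _ _
    (fun {L} f hf ↦ ObjectProperty.homMk (cokernel.desc (deltaY R r rfl rfl) f.hom
      congr(($hf).hom)))
    (fun {L} f hf ↦ by ext : 1; exact cokernel.π_desc _ _ _)
    (fun {L} f hf m hm ↦ by
      ext : 1
      refine (cancel_epi (cokernel.π (deltaY R r (p := p) (n := n) rfl rfl))).1 ?_
      exact congr(($hm).hom).trans (cokernel.π_desc _ _ _).symm)

lemma Z_hom_ext {L : LWB R} {r : ℕ} {p n : ℤ} {f g : Z R r p n ⟶ L}
    (h : πZ R r p n ≫ f = πZ R r p n ≫ g) : f = g :=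
  Cofork.IsColimit.hom_ext (isColimitZ R r p n) h

/-- `𝒵(r, p, n)` represents the cycles: a cycle in `L(r, p, n)` gives a morphism
`𝒵(r, p, n) ⟶ L`. -/
lemma exists_of_cycle {L : LWB R} {r : ℕ} {p n : ℤ} (x : L.obj.obj (op ⟨r, p, n⟩))
    (hx : L.obj.map (Disc.δ R r (p := p) (n := n) rfl rfl).op x = 0) :
    ∃ f : Z R r p n ⟶ L, πZ R r p n ≫ f = ofElement x :=
  ⟨_, (CokernelCofork.IsColimit.desc' (isColimitZ R r p n) (ofElement x)
    (by rw [deltaYHom_comp_eq_zero_iff, ofElement_universalElement, hx])).2⟩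

lemma isZero_zeroBook : IsZero (zeroBook R) := by
  rw [IsZero.iff_id_eq_zero]
  refine hom_ext_apply fun X x ↦ ?_
  exact Subsingleton.elim (α := PUnit) _ _

/-! ### Presentability and the small object argument -/

/-- The Yoneda isomorphism: `𝒴(r, p, n)` represents `L ↦ L(r, p, n)`. -/
noncomputable def evaluationIso (R : Type u) [CommRing R] (r : ℕ) (p n : ℤ) :
    (isLinearPresheaf R).ι ⋙ (evaluation _ _).obj (op ⟨r, p, n⟩) ⋙ forget (ModuleCat.{u} R) ≅
      coyoneda.obj (op (Y R r p n)) :=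
  NatIso.ofComponents (fun L ↦ Equiv.toIso
    { toFun x := ofElement x
      invFun f := f.hom.app _ (universalElement R r p n)
      left_inv x := ofElement_universalElement x
      right_inv f := Y_hom_ext (ofElement_universalElement _) }) (fun {K L} f ↦ by
    ext x
    refine Y_hom_ext ?_
    refine (ofElement_universalElement _).trans ?_
    exact congrArg (fun y ↦ f.hom.app (op ⟨r, p, n⟩) y) (ofElement_universalElement x).symm)

instance isCardinalPresentable_Y (κ : Cardinal.{u}) [Fact κ.IsRegular] (r : ℕ) (p n : ℤ) :
    IsCardinalPresentable (Y R r p n) κ := by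
  have : Functor.IsCardinalAccessible (forget (ModuleCat.{u} R)) κ :=
    ⟨fun J _ _ ↦ by
      have := isFiltered_of_isCardinalFiltered J κ
      infer_instance⟩
  exact Functor.isCardinalAccessible_of_natIso (evaluationIso R r p n) κ

instance isCardinalPresentable_Z (κ : Cardinal.{u}) [Fact κ.IsRegular] (r : ℕ) (p n : ℤ) :
    IsCardinalPresentable (Z R r p n) κ := by
  have (k : WalkingParallelPair) :
      IsCardinalPresentable ((parallelPair (deltaYHom R r (p := p) (n := n) rfl rfl) 0).obj k)
        κ := by
    cases k <;> exact isCardinalPresentable_Y κ _ _ _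
  exact isCardinalPresentable_of_isColimit _ (isColimitZ R r p n) κ
    (hasCardinalLT_of_finite _ _ (Fact.out : κ.IsRegular).aleph0_le)

instance isCardinalPresentable_zeroBook (κ : Cardinal.{u}) [Fact κ.IsRegular] :
    IsCardinalPresentable (zeroBook R) κ := by
  have (k : Discrete PEmpty.{1}) :
      IsCardinalPresentable ((Functor.empty.{0} (LWB R)).obj k) κ := k.as.elim
  exact isCardinalPresentable_of_isColimit _ (isZero_zeroBook (R := R)).isInitial κ
    (hasCardinalLT_of_finite _ _ (Fact.out : κ.IsRegular).aleph0_le)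

/-- A generating class whose sources are finitely presentable permits the small object
argument. -/
lemma hasSmallObjectArgument (W : MorphismProperty (LWB R)) [MorphismProperty.IsSmall.{u} W]
    [Fact Cardinal.aleph0.{u}.IsRegular]
    (hW : ∀ ⦃A B : LWB R⦄ (i : A ⟶ B), W i → IsCardinalPresentable A Cardinal.aleph0.{u}) :
    MorphismProperty.HasSmallObjectArgument.{u} W := by
  have : Nonempty Cardinal.aleph0.{u}.ord.ToType := by simp
  refine ⟨Cardinal.aleph0, inferInstance, WellFoundedLT.toOrderBot _, ?_⟩
  let := WellFoundedLT.toOrderBot Cardinal.aleph0.{u}.ord.ToType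
  exact
    { preservesColimit := fun {A B X Y} i hi f hf ↦ by
        have := hW i hi
        have := preservesColimitsOfShape_of_isCardinalPresentable A Cardinal.aleph0.{u}
          Cardinal.aleph0.{u}.ord.ToType
        infer_instance }

lemma isSmallRelativeTo_of_isCardinalPresentable (A : LWB R) (W : MorphismProperty (LWB R))
    [Fact Cardinal.aleph0.{u}.IsRegular] [IsCardinalPresentable A Cardinal.aleph0.{u}] :
    IsSmallRelativeTo.{u} A W :=
  ⟨Cardinal.aleph0, inferInstance, fun J _ _ _ _ _ F _ _ ↦ by
    have := preservesColimitsOfShape_of_isCardinalPresentable A Cardinal.aleph0.{u} J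
    infer_instance⟩

end LWB

/-! ### Quasi-isomorphisms in terms of elements -/

/-- A morphism of short complexes of modules is a quasi-isomorphism if and only if it is injective
and surjective on homology, in terms of elements. -/
lemma ModuleCat.shortComplex_quasiIso_iff {R : Type u} [Ring R]
    {S₁ S₂ : ShortComplex (ModuleCat.{v} R)} (φ : S₁ ⟶ S₂)
    {f₁ : S₁.X₁ ⟶ S₁.X₂} {g₁ : S₁.X₂ ⟶ S₁.X₃} {f₂ : S₂.X₁ ⟶ S₂.X₂} {g₂ : S₂.X₂ ⟶ S₂.X₃}
    (hf₁ : S₁.f = f₁) (hg₁ : S₁.g = g₁) (hf₂ : S₂.f = f₂) (hg₂ : S₂.g = g₂) :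
    ShortComplex.QuasiIso φ ↔
      (∀ (x : S₁.X₂) (y : S₂.X₁), g₁ x = 0 → f₂ y = φ.τ₂ x → ∃ z : S₁.X₁, f₁ z = x) ∧
      (∀ y : S₂.X₂, g₂ y = 0 → ∃ (x : S₁.X₂) (z : S₂.X₁), g₁ x = 0 ∧ φ.τ₂ x + f₂ z = y) := by
  subst hf₁ hg₁ hf₂ hg₂
  let h₁ := S₁.moduleCatLeftHomologyData
  let h₂ := S₂.moduleCatLeftHomologyData
  let γ : ShortComplex.LeftHomologyMapData φ h₁ h₂ := default
  have hK (x : h₁.K) : (h₂.i (γ.φK x) : S₂.X₂) = φ.τ₂ (h₁.i x) := congr($(γ.commi) x)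
  have hπ (x : h₁.K) : γ.φH (h₁.π x) = h₂.π (γ.φK x) := congr($(γ.commπ) x)
  have hmem₁ (x : h₁.K) : h₁.π x = 0 ↔ ∃ z, S₁.f z = h₁.i x := by
    refine (Submodule.Quotient.mk_eq_zero _).trans ?_
    exact ⟨fun ⟨z, hz⟩ ↦ ⟨z, congr_arg Subtype.val hz⟩, fun ⟨z, hz⟩ ↦ ⟨z, Subtype.ext hz⟩⟩
  have hmem₂ (x : h₂.K) : h₂.π x = 0 ↔ ∃ z, S₂.f z = h₂.i x := by
    refine (Submodule.Quotient.mk_eq_zero _).trans ?_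
    exact ⟨fun ⟨z, hz⟩ ↦ ⟨z, congr_arg Subtype.val hz⟩, fun ⟨z, hz⟩ ↦ ⟨z, Subtype.ext hz⟩⟩
  have hsurj₁ : Function.Surjective h₁.π := (ModuleCat.epi_iff_surjective _).1 inferInstance
  have hsurj₂ : Function.Surjective h₂.π := (ModuleCat.epi_iff_surjective _).1 inferInstance
  have hcyc₁ (x : S₁.X₂) (hx : S₁.g x = 0) : ∃ x' : h₁.K, h₁.i x' = x := ⟨⟨x, hx⟩, rfl⟩
  have hcyc₂ (x : S₂.X₂) (hx : S₂.g x = 0) : ∃ x' : h₂.K, h₂.i x' = x := ⟨⟨x, hx⟩, rfl⟩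
  rw [γ.quasiIso_iff, ConcreteCategory.isIso_iff_bijective]
  refine and_congr ?_ ?_
  · rw [injective_iff_map_eq_zero]
    constructor
    · intro h x y hx hy
      obtain ⟨x, rfl⟩ := hcyc₁ x hx
      refine (hmem₁ x).1 (h _ ?_)
      rw [hπ, hmem₂]
      exact ⟨y, hy.trans (hK _).symm⟩
    · intro h x hx
      obtain ⟨x, rfl⟩ := hsurj₁ x
      rw [hπ, hmem₂] at hx
      obtain ⟨y, hy⟩ := hx
      rw [hmem₁]
      exact h _ y x.2 (hy.trans (hK x))
  · constructor
    · intro h y hy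
      obtain ⟨y, rfl⟩ := hcyc₂ y hy
      obtain ⟨x, hx⟩ := h (h₂.π y)
      obtain ⟨x, rfl⟩ := hsurj₁ x
      rw [hπ, eq_comm, ← sub_eq_zero, ← _root_.map_sub, hmem₂] at hx
      obtain ⟨z, hz⟩ := hx
      refine ⟨_, z, x.2, ?_⟩
      rw [hz, _root_.map_sub, hK]
      exact add_sub_cancel _ _
    · intro h y
      obtain ⟨y, rfl⟩ := hsurj₂ y
      obtain ⟨x, z, hx, hz⟩ := h _ y.2
      obtain ⟨x, rfl⟩ := hcyc₁ x hx
      refine ⟨h₁.π x, ?_⟩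
      rw [hπ, eq_comm, ← sub_eq_zero, ← _root_.map_sub, hmem₂]
      refine ⟨z, ?_⟩
      rw [_root_.map_sub, hK, eq_sub_iff_add_eq']
      exact hz

namespace LWB

variable {R : Type u} [CommRing R]

lemma pageComplex_d_eq (r : ℕ) (L : LWB R) {p n p' n' : ℤ} (hp : p' = p - r)
    (hn : n' = n - r + 1) :
    (pageComplex r L).d (p, n) (p', n') = L.obj.map (Disc.δ R r hp hn).op := by
  rw [pageComplex_d, dif_pos]
  ext
  · simp; omega
  · simp; omega

lemma rWeakEquivalences_iff {r : ℕ} {K L : LWB R} (f : K ⟶ L) :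
    rWeakEquivalences R r f ↔
      ∀ (p n p₁ n₁ p₂ n₂ : ℤ) (hp : p = p₁ - r) (hn : n = n₁ - r + 1)
        (hp' : p₂ = p - r) (hn' : n₂ = n - r + 1),
      (∀ (x : K.obj.obj (op ⟨r, p, n⟩)) (y : L.obj.obj (op ⟨r, p₁, n₁⟩)),
        K.obj.map (Disc.δ R r hp' hn').op x = 0 →
        L.obj.map (Disc.δ R r hp hn).op y = f.hom.app _ x →
          ∃ z, K.obj.map (Disc.δ R r hp hn).op z = x) ∧
      (∀ (y : L.obj.obj (op ⟨r, p, n⟩)), L.obj.map (Disc.δ R r hp' hn').op y = 0 →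
        ∃ (x : K.obj.obj (op ⟨r, p, n⟩)) (z : L.obj.obj (op ⟨r, p₁, n₁⟩)),
          K.obj.map (Disc.δ R r hp' hn').op x = 0 ∧
          f.hom.app _ x + L.obj.map (Disc.δ R r hp hn).op z = y) := by
  have key (p n p₁ n₁ p₂ n₂ : ℤ) (hp : p = p₁ - r) (hn : n = n₁ - r + 1)
      (hp' : p₂ = p - r) (hn' : n₂ = n - r + 1) :=
    (quasiIsoAt_iff' ((page r).map f) (p₁, n₁) (p, n) (p₂, n₂)
      ((pageShape r).prev_eq' (by ext <;> simp <;> omega))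
      ((pageShape r).next_eq' (by ext <;> simp <;> omega))).trans
      (ModuleCat.shortComplex_quasiIso_iff _ (pageComplex_d_eq r K hp hn)
        (pageComplex_d_eq r K hp' hn') (pageComplex_d_eq r L hp hn) (pageComplex_d_eq r L hp' hn'))
  refine (quasiIso_iff _).trans ⟨fun h p n p₁ n₁ p₂ n₂ hp hn hp' hn' ↦ ?_, fun h ⟨p, n⟩ ↦ ?_⟩
  · exact (key p n p₁ n₁ p₂ n₂ hp hn hp' hn').1 (h _)
  · exact (key p n (p + r) (n + r - 1) _ _ (by ring) (by ring) rfl rfl).2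
      (h p n _ _ _ _ _ _ _ _)

instance rWeakEquivalences_hasTwoOutOfThreeProperty (r : ℕ) :
    (rWeakEquivalences R r).HasTwoOutOfThreeProperty :=
  inferInstanceAs
    ((HomologicalComplex.quasiIso (ModuleCat.{u} R) (pageShape r)).inverseImage
      (page r)).HasTwoOutOfThreeProperty

instance rWeakEquivalences_isStableUnderRetracts (r : ℕ) :
    (rWeakEquivalences R r).IsStableUnderRetracts where
  of_retract h (_ : QuasiIso _) :=
    quasiIso_of_retractArrow (h.map (page r))

/-! ### Lifting properties -/

lemma hasLiftingProperty_zeroToY_iff {K L : LWB R} (f : K ⟶ L) (r : ℕ) (p n : ℤ) :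
    HasLiftingProperty (zeroToY R r p n) f ↔
      Function.Surjective (f.hom.app (op ⟨r, p, n⟩)) := by
  constructor
  · intro h y
    have sq : CommSq (isZero_zeroBook.to_ K) (zeroToY R r p n) f (ofElement y) :=
      ⟨isZero_zeroBook.eq_of_src _ _⟩
    refine ⟨sq.lift.hom.app _ (universalElement R r p n), ?_⟩
    rw [← comp_app_apply, sq.fac_right, ofElement_universalElement]
  · intro h
    refine ⟨fun {t b} sq ↦ ?_⟩
    obtain ⟨x, hx⟩ := h (b.hom.app _ (universalElement R r p n))
    refine ⟨⟨⟨ofElement x, isZero_zeroBook.eq_of_src _ _, Y_hom_ext ?_⟩⟩⟩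
    rw [comp_app_apply, ofElement_universalElement, hx]

/-- The lifting property with respect to `δ_r : 𝒵(r, p, n) ⟶ 𝒴(r, p₁, n₁)`, where `p₁ = p + r` and
`n₁ = n + r - 1`, in terms of elements. -/
lemma hasLiftingProperty_deltaZ_iff {K L : LWB R} (f : K ⟶ L) (r : ℕ) {p n p₁ n₁ p₂ n₂ : ℤ}
    (hp : p = p₁ - r) (hn : n = n₁ - r + 1) (hp' : p₂ = p - r) (hn' : n₂ = n - r + 1) :
    HasLiftingProperty (deltaZ R r p n) f ↔
      ∀ (x : K.obj.obj (op ⟨r, p, n⟩)) (y : L.obj.obj (op ⟨r, p₁, n₁⟩)),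
        K.obj.map (Disc.δ R r hp' hn').op x = 0 →
        L.obj.map (Disc.δ R r hp hn).op y = f.hom.app _ x →
          ∃ z, K.obj.map (Disc.δ R r hp hn).op z = x ∧ f.hom.app _ z = y := by
  obtain rfl : p₁ = p + r := by omega
  obtain rfl : n₁ = n + r - 1 := by omega
  subst hp' hn'
  have hδ {M : LWB R} (g : Y R r (p + r) (n + r - 1) ⟶ M) :
      (deltaYHom R r hp hn ≫ g).hom.app _ (universalElement R r p n) =
        M.obj.map (Disc.δ R r hp hn).op (g.hom.app _ (universalElement R r _ _)) := by
    rw [comp_app_apply, deltaYHom_universalElement, naturality_apply]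
  constructor
  · intro h x y hx hy
    obtain ⟨t, ht⟩ := exists_of_cycle x hx
    have sq : CommSq t (deltaZ R r p n) f (ofElement y) := ⟨by
      refine Z_hom_ext (Y_hom_ext ?_)
      rw [← Category.assoc, ht, ← Category.assoc, πZ_comp_deltaZ, hδ, comp_app_apply,
        ofElement_universalElement, ofElement_universalElement, hy]⟩
    refine ⟨sq.lift.hom.app _ (universalElement R r _ _), ?_, ?_⟩
    · rw [← hδ, ← πZ_comp_deltaZ, Category.assoc, sq.fac_left, ht, ofElement_universalElement]
    · rw [← comp_app_apply, sq.fac_right, ofElement_universalElement]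
  · intro h
    refine ⟨fun {t b} sq ↦ ?_⟩
    obtain ⟨z, hz, hz'⟩ := h ((πZ R r p n ≫ t).hom.app _ (universalElement R r p n))
      (b.hom.app _ (universalElement R r _ _))
      (by rw [← deltaYHom_comp_eq_zero_iff, ← Category.assoc, deltaYHom_comp_πZ, zero_comp])
      (by rw [← hδ, ← πZ_comp_deltaZ, Category.assoc, ← sq.w, ← Category.assoc]; rfl)
    refine ⟨⟨⟨ofElement z, Z_hom_ext (Y_hom_ext ?_), Y_hom_ext ?_⟩⟩⟩
    · rw [← Category.assoc, πZ_comp_deltaZ, hδ, ofElement_universalElement, hz]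
    · rw [comp_app_apply, ofElement_universalElement, hz']

lemma rlp_J_iff {K L : LWB R} (f : K ⟶ L) (i : ℕ) :
    (J R i).rlp f ↔ ∀ b : ℤ × ℤ, Function.Surjective (((page i).map f).f b) := by
  constructor
  · intro h b
    exact (hasLiftingProperty_zeroToY_iff f i b.1 b.2).1 (h _ ⟨b⟩)
  · rintro h _ _ _ ⟨b⟩
    exact (hasLiftingProperty_zeroToY_iff f i b.1 b.2).2 (h b)

/-- A morphism has the right lifting property with respect to `I_r` if and only if it is
surjective on the page `r` and a quasi-isomorphism there. -/
lemma rlp_I_iff {K L : LWB R} (f : K ⟶ L) (r : ℕ) :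
    (I R r).rlp f ↔ (∀ b : ℤ × ℤ, Function.Surjective (((page r).map f).f b)) ∧
      rWeakEquivalences R r f := by
  have hI : (I R r).rlp f ↔ ∀ p n : ℤ, HasLiftingProperty (deltaZ R r p n) f :=
    ⟨fun h p n ↦ h _ ⟨(p, n)⟩, by rintro h _ _ _ ⟨b⟩; exact h b.1 b.2⟩
  rw [rWeakEquivalences_iff, hI]
  constructor
  · intro h
    replace h {p n p₁ n₁ : ℤ} (hp : p = p₁ - r) (hn : n = n₁ - r + 1) :=
      (hasLiftingProperty_deltaZ_iff f r hp hn rfl rfl).1 (h p n)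
    -- Every cycle of `L` lifts to a cycle of `K`: apply the lifting property to the cycle `0`.
    have hcycle {p n p₂ n₂ : ℤ} (hp' : p₂ = p - r) (hn' : n₂ = n - r + 1)
        (y : L.obj.obj (op ⟨r, p, n⟩)) (hy : L.obj.map (Disc.δ R r hp' hn').op y = 0) :
        ∃ x, K.obj.map (Disc.δ R r hp' hn').op x = 0 ∧ f.hom.app _ x = y :=
      h hp' hn' 0 y (_root_.map_zero _) (by rw [hy, _root_.map_zero])
    have hsurj (p n : ℤ) (y : L.obj.obj (op ⟨r, p, n⟩)) : ∃ z, f.hom.app _ z = y := by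
      obtain ⟨x, hx, hx'⟩ := hcycle (p₂ := p - r - r) (n₂ := n - r + 1 - r + 1) rfl rfl
        (L.obj.map (Disc.δ R r rfl rfl).op y) (map_delta_map_delta L r rfl rfl rfl rfl y)
      obtain ⟨z, -, hz⟩ := h rfl rfl x y hx hx'.symm
      exact ⟨z, hz⟩
    refine ⟨fun b ↦ hsurj b.1 b.2,
      fun p n p₁ n₁ p₂ n₂ hp hn hp' hn' ↦ ⟨fun x y hx hy ↦ ?_, fun y hy ↦ ?_⟩⟩
    · subst hp' hn'
      obtain ⟨z, hz, -⟩ := h hp hn x y hx hy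
      exact ⟨z, hz⟩
    · obtain ⟨x, hx, rfl⟩ := hcycle hp' hn' y hy
      exact ⟨x, 0, hx, by rw [_root_.map_zero, add_zero]⟩
  · rintro ⟨hsurj, h⟩ p n
    replace hsurj (p n : ℤ) : Function.Surjective (f.hom.app (op ⟨r, p, n⟩)) := hsurj (p, n)
    rw [hasLiftingProperty_deltaZ_iff f r (p₁ := p + r) (n₁ := n + r - 1) (by ring) (by ring)
      rfl rfl]
    intro x y hx hy
    obtain ⟨z, hz⟩ := (h _ _ _ _ _ _ (by ring) (by ring) rfl rfl).1 x y hx hy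
    -- The error term `y - f z` is a cycle, hence of the form `f x' + d y'` with `x'` a cycle.
    obtain ⟨x', y', hx', hy'⟩ := (h (p + r) (n + r - 1) (p + r + r) (n + r - 1 + r - 1) p n
      (by ring) (by ring) (by ring) (by ring)).2 (y - f.hom.app _ z) (by
        rw [_root_.map_sub, hy, ← naturality_apply, hz, sub_self])
    obtain ⟨y'', rfl⟩ := hsurj _ _ y'
    refine ⟨z + (x' + K.obj.map (Disc.δ R r (by ring) (by ring)).op y''), ?_, ?_⟩
    · rw [_root_.map_add, _root_.map_add, hz, hx', map_delta_map_delta, add_zero, add_zero]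
    · rw [_root_.map_add, _root_.map_add, naturality_apply]
      exact (congrArg _ hy').trans (add_sub_cancel _ _)

lemma rlp_JLE (r : ℕ) : (JLE R r).rlp = rFibrations R r := by
  ext K L f
  simp only [JLE, rFibrations, MorphismProperty.rlp, MorphismProperty.iSup_iff]
  constructor
  · intro h i hi
    exact (rlp_J_iff f i).1 fun _ _ g hg ↦ h g ⟨⟨i, Nat.lt_succ_of_le hi⟩, hg⟩
  · rintro h _ _ g ⟨i, hg⟩
    exact (rlp_J_iff f i).2 (h i (Nat.le_of_lt_succ i.2)) g hg

lemma rlp_ILE (r : ℕ) : (ILE R r).rlp = rFibrations R r ⊓ rWeakEquivalences R r := by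
  ext K L f
  constructor
  · intro h
    have hI := (rlp_I_iff f r).1 fun _ _ g hg ↦ h g (Or.inl hg)
    refine ⟨fun i hi ↦ ?_, hI.2⟩
    obtain rfl | hi := hi.eq_or_lt
    · exact hI.1
    · exact (rlp_J_iff f i).1 fun _ _ g hg ↦ h g
        (Or.inr ((MorphismProperty.iSup_iff _ _).2 ⟨⟨i, hi⟩, hg⟩))
  · rintro ⟨h, h'⟩ _ _ g (hg | hg)
    · exact (rlp_I_iff f r).2 ⟨h r le_rfl, h'⟩ g hg
    · obtain ⟨i, hg⟩ := (MorphismProperty.iSup_iff _ _).1 hg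
      exact (rlp_J_iff f i).2 (h i i.2.le) g hg

end LWB

namespace LWB

variable {R : Type u} [CommRing R]

/-! ### Freely adjoining elements -/

section FreeExtension

variable (K : LWB R) {ι : Type u} (D : ι → Disc R)

/-- The linear witness book `K ⊕ ⨁ₖ Hom(-, D k)`, obtained from `K` by freely adjoining one
element in each of the places `D k`. -/
def freeExtension : LWB R where
  obj :=
    { obj X := ModuleCat.of R (K.obj.obj X × Π₀ k, (X.unop ⟶ D k))
      map g := ModuleCat.ofHom ((K.obj.map g).hom.prodMap
        (DFinsupp.mapRange.linearMap fun k ↦ Linear.leftComp R (D k) g.unop))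
      map_id X := by
        refine ModuleCat.hom_ext (LinearMap.ext fun x ↦ Prod.ext ?_ (DFinsupp.ext fun k ↦ ?_))
        · exact congr($(K.obj.map_id X) x.1)
        · exact Category.id_comp (x.2 k : X.unop ⟶ D k)
      map_comp {X Y Z} f g := by
        refine ModuleCat.hom_ext (LinearMap.ext fun x ↦ Prod.ext ?_ (DFinsupp.ext fun k ↦ ?_))
        · exact congr($(K.obj.map_comp f g) x.1)
        · exact Category.assoc g.unop f.unop (x.2 k : X.unop ⟶ D k) }
  property := by
    refine ⟨fun X Y f g ↦ ?_, fun X Y a f ↦ ?_⟩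
    · refine ModuleCat.hom_ext (LinearMap.ext fun x ↦ Prod.ext ?_ (DFinsupp.ext fun k ↦ ?_))
      · exact congr($(K.property.1 f g) x.1)
      · exact Preadditive.add_comp _ _ _ f g _
    · refine ModuleCat.hom_ext (LinearMap.ext fun x ↦ Prod.ext ?_ (DFinsupp.ext fun k ↦ ?_))
      · exact congr($(K.property.2 a f) x.1)
      · exact Linear.smul_comp _ _ _ a f _

/-- The inclusion of `K` into a free extension of `K`. -/
def freeExtensionInl : K ⟶ freeExtension K D :=
  ObjectProperty.homMk
    { app X := ModuleCat.ofHom (LinearMap.inl R _ _)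
      naturality X Y g := by
        ext x
        refine Prod.ext rfl ?_
        exact (_root_.map_zero (DFinsupp.mapRange.linearMap
          fun k ↦ Linear.leftComp R (D k) g.unop)).symm }

variable {K D}

open Classical in
/-- The components of `LWB.freeExtensionDesc`. -/
noncomputable def freeExtensionDescApp {L : LWB R} (f : K ⟶ L)
    (y : ∀ k, L.obj.obj (op (D k))) (X : (Disc R)ᵒᵖ) :
    K.obj.obj X × (Π₀ k, (X.unop ⟶ D k)) →ₗ[R] L.obj.obj X :=
  (f.hom.app X).hom.coprod (DFinsupp.lsum ℕ fun k ↦ ((representableDesc (y k)).app X).hom)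

lemma freeExtensionDescApp_inl {L : LWB R} (f : K ⟶ L) (y : ∀ k, L.obj.obj (op (D k)))
    {X : (Disc R)ᵒᵖ} (x : K.obj.obj X) : freeExtensionDescApp f y X (x, 0) = f.hom.app X x := by
  refine (LinearMap.coprod_apply _ _ _).trans ?_
  exact (congrArg _ (_root_.map_zero _)).trans (add_zero _)

open Classical in
lemma freeExtensionDescApp_single {L : LWB R} (f : K ⟶ L) (y : ∀ k, L.obj.obj (op (D k)))
    {X : (Disc R)ᵒᵖ} (k : ι) (h : X.unop ⟶ D k) :
    freeExtensionDescApp f y X (0, DFinsupp.single k h) = L.obj.map h.op (y k) := by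
  refine (LinearMap.coprod_apply _ _ _).trans ?_
  refine (congrArg₂ (· + ·) (_root_.map_zero _) (DFinsupp.lsum_single _ _ _ _)).trans ?_
  exact zero_add _

/-- The morphism from a free extension of `K` to `L` given by a morphism `f : K ⟶ L` and by the
images in `L` of the adjoined elements. -/
noncomputable def freeExtensionDesc {L : LWB R} (f : K ⟶ L) (y : ∀ k, L.obj.obj (op (D k))) :
    freeExtension K D ⟶ L :=
  ObjectProperty.homMk
    { app X := ModuleCat.ofHom (freeExtensionDescApp f y X)
      naturality X Y g := by
        classical
        refine ModuleCat.hom_ext (LinearMap.prod_ext (LinearMap.ext fun x ↦ ?_)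
          (DFinsupp.lhom_ext' fun k ↦ LinearMap.ext fun (h : X.unop ⟶ D k) ↦ ?_))
        · change freeExtensionDescApp f y Y (K.obj.map g x, DFinsupp.mapRange.linearMap _ 0) =
            L.obj.map g (freeExtensionDescApp f y X (x, 0))
          rw [_root_.map_zero, freeExtensionDescApp_inl, freeExtensionDescApp_inl]
          exact naturality_apply f g.unop x
        · change freeExtensionDescApp f y Y (K.obj.map g 0, DFinsupp.mapRange.linearMap
              (fun k ↦ Linear.leftComp R (D k) g.unop) (DFinsupp.single k h)) =
            L.obj.map g (freeExtensionDescApp f y X (0, DFinsupp.single k h))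
          rw [_root_.map_zero, freeExtensionDescApp_single, DFinsupp.mapRange.linearMap_apply,
            DFinsupp.mapRange_single, freeExtensionDescApp_single]
          exact map_comp_apply L g.unop h (y k) }

lemma freeExtensionInl_comp_desc {L : LWB R} (f : K ⟶ L) (y : ∀ k, L.obj.obj (op (D k))) :
    freeExtensionInl K D ≫ freeExtensionDesc f y = f :=
  hom_ext_apply fun _ x ↦ freeExtensionDescApp_inl f y x

lemma exists_freeExtensionDesc_eq {L : LWB R} (f : K ⟶ L) (y : ∀ k, L.obj.obj (op (D k)))
    (k : ι) : ∃ z, (freeExtensionDesc f y).hom.app (op (D k)) z = y k := by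
  classical
  exact ⟨((0 : K.obj.obj (op (D k))), DFinsupp.single k (𝟙 (D k))),
    (freeExtensionDescApp_single f y k (𝟙 (D k))).trans (map_id_apply L (y k))⟩

/-- Adjoining elements on the pages up to `r` does not change the homology of the page `r`,
because representable linear witness books have exact higher pages. -/
lemma rWeakEquivalences_freeExtensionInl {r : ℕ} (hD : ∀ k, (D k).page ≤ r) :
    rWeakEquivalences R r (freeExtensionInl K D) := by
  rw [rWeakEquivalences_iff]
  intro p n p₁ n₁ p₂ n₂ hp hn hp' hn'
  constructor
  · intro x y hx hy
    exact ⟨y.1, congrArg Prod.fst hy⟩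
  · intro y hy
    classical
    let t : Π₀ k, ((⟨r, p, n⟩ : Disc R) ⟶ D k) := y.2
    have ht (k : ι) : Disc.δ R r hp' hn' ≫ t k = 0 :=
      DFunLike.congr_fun (congrArg Prod.snd hy) k
    choose z hz using fun k ↦ Disc.exists_eq_delta_comp hp hn hp' hn' (hD k) (t k) (ht k)
    let s : Π₀ k, ((⟨r, p₁, n₁⟩ : Disc R) ⟶ D k) := DFinsupp.mk t.support fun k ↦ z k
    refine ⟨y.1, ((0 : K.obj.obj (op ⟨r, p₁, n₁⟩)), s), congrArg Prod.fst hy, ?_⟩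
    refine Prod.ext ?_ (DFinsupp.ext fun k ↦ ?_)
    · exact (congrArg (y.1 + ·) (_root_.map_zero (K.obj.map (Disc.δ R r hp hn).op).hom)).trans
        (add_zero y.1)
    · refine (zero_add (Disc.δ R r hp hn ≫ s k)).trans ?_
      change _ = t k
      rw [DFinsupp.mk_apply]
      split_ifs with hk
      · exact (hz k).symm
      · rw [comp_zero]
        exact (DFinsupp.notMem_support_iff.1 hk).symm

end FreeExtension

/-- Any morphism factors as the inclusion into a free extension, followed by an `r`-fibration:
adjoin an element for every element of the target on the pages up to `r`. -/
lemma exists_factorization (r : ℕ) {K L : LWB R} (f : K ⟶ L) :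
    ∃ (M : LWB R) (i : K ⟶ M) (q : M ⟶ L), i ≫ q = f ∧ rWeakEquivalences R r i ∧
      rFibrations R r q := by
  let ι := Σ d : {d : Disc R // d.page ≤ r}, L.obj.obj (op d.1)
  let D (k : ι) : Disc R := k.1.1
  refine ⟨freeExtension K D, freeExtensionInl K D, freeExtensionDesc f fun k ↦ k.2,
    freeExtensionInl_comp_desc _ _, rWeakEquivalences_freeExtensionInl fun k ↦ k.1.2,
    fun i hi b y ↦ ?_⟩
  exact exists_freeExtensionDesc_eq f (fun k : ι ↦ k.2) ⟨⟨⟨i, b.1, b.2⟩, hi⟩, y⟩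

/-- The morphisms with the left lifting property with respect to the `r`-fibrations are `r`-weak
equivalences, as they are retracts of inclusions into free extensions. -/
lemma llp_rFibrations_le (r : ℕ) : (rFibrations R r).llp ≤ rWeakEquivalences R r := by
  intro K L f hf
  obtain ⟨M, i, q, fac, hi, hq⟩ := exists_factorization r f
  have := hf q hq
  exact MorphismProperty.of_retract (RetractArrow.ofLeftLiftingProperty fac) hi

end LWB

namespace LWB

variable (R : Type u) [CommRing R]

/-! ### The model structure -/

instance isSmall_I (r : ℕ) : MorphismProperty.IsSmall.{u} (I R r) :=
  MorphismProperty.isSmall_ofHoms _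

instance isSmall_J (r : ℕ) : MorphismProperty.IsSmall.{u} (J R r) :=
  MorphismProperty.isSmall_ofHoms _

instance isSmall_JLE (r : ℕ) : MorphismProperty.IsSmall.{u} (JLE R r) := by
  unfold JLE; infer_instance

instance isSmall_ILE (r : ℕ) : MorphismProperty.IsSmall.{u} (ILE R r) := by
  have (b : Bool) : MorphismProperty.IsSmall.{u} (cond b (I R r) (⨆ i : Fin r, J R i)) := by
    cases b <;> dsimp <;> infer_instance
  rw [ILE, sup_eq_iSup]
  infer_instance

variable {R}

lemma isCardinalPresentable_of_J (κ : Cardinal.{u}) [Fact κ.IsRegular] {i : ℕ} {A B : LWB R}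
    {f : A ⟶ B} (hf : J R i f) : IsCardinalPresentable A κ := by
  obtain ⟨b⟩ := hf
  infer_instance

lemma isCardinalPresentable_of_JLE (κ : Cardinal.{u}) [Fact κ.IsRegular] {r : ℕ} {A B : LWB R}
    {f : A ⟶ B} (hf : JLE R r f) : IsCardinalPresentable A κ := by
  obtain ⟨i, hf⟩ := (MorphismProperty.iSup_iff _ _).1 hf
  exact isCardinalPresentable_of_J κ hf

lemma isCardinalPresentable_of_ILE (κ : Cardinal.{u}) [Fact κ.IsRegular] {r : ℕ} {A B : LWB R}
    {f : A ⟶ B} (hf : ILE R r f) : IsCardinalPresentable A κ := by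
  obtain ⟨⟨b⟩⟩ | hf := hf
  · exact isCardinalPresentable_Z κ r b.1 b.2
  · obtain ⟨i, hf⟩ := (MorphismProperty.iSup_iff _ _).1 hf
    exact isCardinalPresentable_of_J κ hf

/-- The `r`-cofibrations: morphisms with the left lifting property with respect to the
`r`-fibrations which are `r`-weak equivalences. -/
def rCofibrations (R : Type u) [CommRing R] (r : ℕ) : MorphismProperty (LWB R) :=
  (rFibrations R r ⊓ rWeakEquivalences R r).llp

/-- The inclusion `⊇` is `LWB.llp_rFibrations_le`. For the other inclusion, factor an acyclic
cofibration by the small object argument for `J_{≤ r}` and apply the retract argument. -/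
lemma rCofibrations_inf_rWeakEquivalences (r : ℕ)
    [MorphismProperty.HasFactorization (rFibrations R r).llp (rFibrations R r)] :
    rCofibrations R r ⊓ rWeakEquivalences R r = (rFibrations R r).llp := by
  refine le_antisymm ?_ (le_inf (MorphismProperty.antitone_llp inf_le_left)
    (llp_rFibrations_le r))
  rintro K L f ⟨hf, hf'⟩
  let h := MorphismProperty.factorizationData (rFibrations R r).llp (rFibrations R r) f
  have hp : rWeakEquivalences R r h.p :=
    (rWeakEquivalences R r).of_precomp h.i h.p (llp_rFibrations_le r _ h.hi)
      (by rwa [h.fac])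
  have := hf h.p ⟨h.hp, hp⟩
  exact MorphismProperty.of_retract (RetractArrow.ofLeftLiftingProperty h.fac) h.hi

end LWB

theorem theoremT (R : Type u) [CommRing R] (r : ℕ) :
    HasLimitsOfSize.{u, u} (LWB R) ∧ HasColimitsOfSize.{u, u} (LWB R) ∧
    ∃ _ : ModelCategory (LWB R),
      MorphismProperty.HasFunctorialFactorization
        (trivialCofibrations (LWB R)) (fibrations (LWB R)) ∧
      MorphismProperty.HasFunctorialFactorization
        (cofibrations (LWB R)) (trivialFibrations (LWB R)) ∧
      IsCofibrantlyGenerated.{u, u, u + 1} (LWB.ILE R r) (LWB.JLE R r) ∧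
      fibrations (LWB R) = LWB.rFibrations R r ∧
      weakEquivalences (LWB R) = LWB.rWeakEquivalences R r := by
  refine ⟨inferInstance, inferInstance, ?_⟩
  have : Fact Cardinal.aleph0.{u}.IsRegular := Cardinal.fact_isRegular_aleph0
  have := LWB.hasSmallObjectArgument (LWB.ILE R r)
    fun _ _ _ ↦ LWB.isCardinalPresentable_of_ILE _
  have := LWB.hasSmallObjectArgument (LWB.JLE R r)
    fun _ _ _ ↦ LWB.isCardinalPresentable_of_JLE _
  have hJ : MorphismProperty.HasFunctorialFactorization (LWB.rFibrations R r).llp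
      (LWB.rFibrations R r) := by
    rw [← LWB.rlp_JLE]; infer_instance
  have hI : MorphismProperty.HasFunctorialFactorization (LWB.rCofibrations R r)
      (LWB.rFibrations R r ⊓ LWB.rWeakEquivalences R r) := by
    rw [LWB.rCofibrations, ← LWB.rlp_ILE]; infer_instance
  have htriv := LWB.rCofibrations_inf_rWeakEquivalences (R := R) r
  let : CategoryWithFibrations (LWB R) := ⟨LWB.rFibrations R r⟩
  let : CategoryWithCofibrations (LWB R) := ⟨LWB.rCofibrations R r⟩
  let : CategoryWithWeakEquivalences (LWB R) := ⟨LWB.rWeakEquivalences R r⟩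
  have hJ' : MorphismProperty.HasFunctorialFactorization
      (trivialCofibrations (LWB R)) (fibrations (LWB R)) := by
    rw [← htriv] at hJ; exact hJ
  have hI' : MorphismProperty.HasFunctorialFactorization
      (cofibrations (LWB R)) (trivialFibrations (LWB R)) := hI
  have : (weakEquivalences (LWB R)).HasTwoOutOfThreeProperty :=
    LWB.rWeakEquivalences_hasTwoOutOfThreeProperty r
  have : (fibrations (LWB R)).IsStableUnderRetracts := by
    change (LWB.rFibrations R r).IsStableUnderRetracts
    rw [← LWB.rlp_JLE]; infer_instance
  let model : ModelCategory (LWB R) :=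
    { categoryWithFibrations := inferInstance
      categoryWithCofibrations := inferInstance
      categoryWithWeakEquivalences := inferInstance
      cm1a := hasFiniteLimits_of_hasLimitsOfSize.{u, u} _
      cm1b := hasFiniteColimits_of_hasColimitsOfSize.{u, u} _
      cm3a := LWB.rWeakEquivalences_isStableUnderRetracts r
      cm3c := MorphismProperty.llp_isStableUnderRetracts _
      cm4a := fun i p hi hi' hp ↦ htriv.le i ⟨hi.mem, hi'.mem⟩ p hp.mem
      cm4b := fun i p hi hp hp' ↦ hi.mem p ⟨hp.mem, hp'.mem⟩ }
  exact ⟨model, hJ', hI',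
    { isSmall_I := inferInstance
      isSmall_J := inferInstance
      small_I := fun A _ _ hi ↦
        have := LWB.isCardinalPresentable_of_ILE Cardinal.aleph0.{u} hi
        LWB.isSmallRelativeTo_of_isCardinalPresentable A _
      small_J := fun A _ _ hj ↦
        have := LWB.isCardinalPresentable_of_JLE Cardinal.aleph0.{u} hj
        LWB.isSmallRelativeTo_of_isCardinalPresentable A _
      fibrations_eq := (LWB.rlp_JLE r).symm
      trivialFibrations_eq := (LWB.rlp_ILE r).symm }, rfl, rfl⟩
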